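/- Let $M_2(\mathbb{R})$ denote the real $2\times 2$ matrices. For $\mathsf{A}=(A_1,A_2)\in M_2(\mathbb{R})^2$ define the lower spectral radius \[\underline{\varrho}(\mathsf{A}):=\lim_{n\to\infty}\min\left\{\|A_{i_n}\cdots A_{i_1}\|^{1/n}\colon i_1,\ldots,i_n\in\{1,2\}\right\},\] where $\|\cdot\|$ is the Euclidean operator norm. Say that $\mathsf{A}$ has the lower finiteness property if there are $n\ge 1$ and $i_1,\ldots,i_n\in\{1,2\}$ with $\underline{\varrho}(\mathsf{A})=\rho(A_{i_1}\cdots A_{i_n})^{1/n}$, where $\rho$ is the ordinary spectral radius (the largest modulus of a complex eigenvalue). Let $\mathcal{P}\subset M_2(\mathbb{R})$ be the set of all non-nilpotent rank-one matrices and $\mathcal{E}\subset M_2(\mathbb{R})$ the set of all matrices with non-real eigenvalues. The set $\mathcal{P}\times\mathcal{E}$ is a $7$-dimensional submanifold of $M_2(\mathbb{R})^2\cong\mathbb{R}^8$. Let $D$ be any set with $\mathcal{P}\times\mathcal{E}\subseteq D\subseteq M_2(\mathbb{R})^2$ (for instance $D=\mathcal{P}\times\mathcal{E}$ or $D=M_2(\mathbb{R})^2$),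 and regard $\underline{\varrho}$ as a function $D\to\mathbb{R}$ when speaking of its continuity at a point. Define: - $\mathcal{U}_1$ is the set of all $\mathsf{A}\in\mathcal{P}\times\mathcal{E}$ such that $\underline{\varrho}(\mathsf{A})=0$, $\underline{\varrho}$ is continuous at $\mathsf{A}$, and $\mathsf{A}$ does not have the lower finiteness property. - $\mathcal{U}_2$ is the set of all $\mathsf{A}\in\mathcal{P}\times\mathcal{E}$ such that $\underline{\varrho}(\mathsf{A})=0$, $\underline{\varrho}$ is continuous at $\mathsf{A}$, and $\mathsf{A}$ has the lower finiteness property. - $\mathcal{U}_3$ is the set of all $\mathsf{A}\in\mathcal{P}\times\mathcal{E}$ such that $\underline{\varrho}(\mathsf{A})>0$, $\underline{\varrho}$ is discontinuous at $\mathsf{A}$, and $\mathsf{A}$ does not have the lower finiteness property. - $\mathcal{U}_4$ is the set of all $\mathsf{A}\in\mathcal{P}\times\mathcal{E}$ such that $\underline{\varrho}(\mathsf{A})>0$, $\underline{\varrho}$ is discontinuous at $\mathsf{A}$, and $\mathsf{A}$ has the lower finiteness property. Then $\mathcal{P}\times\mathcal{E}$ is the disjoint union of the four sets $\mathcal{U}_1,\ldots,\mathcal{U}_4$,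 and each $\mathcal{U}_i$ is dense in $\mathcal{P}\times\mathcal{E}$. The set $\mathcal{U}_1$ is equal to a countable intersection of dense (relatively) open subsets of $\mathcal{P}\times\mathcal{E}$. The set $\mathcal{U}_4$ has full Lebesgue measure in $\mathcal{P}\times\mathcal{E}$, that is, $(\mathcal{P}\times\mathcal{E})\setminus\mathcal{U}_4$ has $7$-dimensional Lebesgue (equivalently, Hausdorff) measure zero. -/

import Mathlib

open Filter Topology Set MeasureTheory
open scoped ENNReal

namespace LowerSpectral

/-- `d × d` real matrices. -/
abbrev Mat (d : ℕ) : Type := Matrix (Fin d) (Fin d) ℝ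

/-- The (ordinary) spectral radius of a real square matrix: the largest modulus of its
complex eigenvalues. -/
noncomputable def rho {d : ℕ} (M : Mat d) : ℝ :=
  (spectralRadius ℂ (M.map (algebraMap ℝ ℂ))).toReal

/-- The words of length `n` over a set of matrices. -/
def words {d : ℕ} (A : Set (Mat d)) (n : ℕ) : Set (List (Mat d)) :=
  {w | w.length = n ∧ ∀ B ∈ w, B ∈ A}

section
open scoped Matrix.Norms.L2Operator

/-- `inf { ‖A_n ⋯ A_1‖ ^ (1 / n) : A_i ∈ A }`, with the Euclidean operator norm. -/
noncomputable def minGrowth {d : ℕ} (A : Set (Mat d)) (n : ℕ) : ℝ :=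
  sInf ((fun w : List (Mat d) => ‖w.prod‖ ^ (1 / (n : ℝ))) '' words A n)

end

/-- The lower spectral radius of a set of matrices,
`lim_{n → ∞} inf { ‖A_n ⋯ A_1‖ ^ (1 / n) : A_i ∈ A }`.
The limit exists for every nonempty `A`, see `tendsto_minGrowth` below. -/
noncomputable def lowerSpectralRadius {d : ℕ} (A : Set (Mat d)) : ℝ :=
  limUnder atTop (minGrowth A)

/-- `A` has the lower finiteness property: its lower spectral radius is
`ρ(A_1 ⋯ A_n) ^ (1 / n)` for some nonempty finite sequence of elements of `A`. -/
def LowerFiniteness {d : ℕ} (A : Set (Mat d)) : Prop :=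
  ∃ n : ℕ, 1 ≤ n ∧ ∃ w ∈ words A n, lowerSpectralRadius A = rho w.prod ^ (1 / (n : ℝ))

/-- The lower spectral radius as a function of an ordered pair of `2 × 2` matrices. -/
noncomputable def lsr (p : Mat 2 × Mat 2) : ℝ := lowerSpectralRadius {p.1, p.2}

/-- The lower finiteness property of an ordered pair of `2 × 2` matrices. -/
def HasLFP (p : Mat 2 × Mat 2) : Prop := LowerFiniteness {p.1, p.2}

/-- Rank-one `2 × 2` real matrices which are not nilpotent. -/
def setP : Set (Mat 2) := {M | M.rank = 1 ∧ ¬ IsNilpotent M}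

/-- `2 × 2` real matrices with non-real eigenvalues. -/
def setE : Set (Mat 2) := {M | ∀ z ∈ spectrum ℂ (M.map (algebraMap ℝ ℂ)), z.im ≠ 0}

/-- The product of the two sets, inside the space of pairs of `2 × 2` matrices. -/
def setPE : Set (Mat 2 × Mat 2) := setP ×ˢ setE

/-! In the four sets below, continuity is that of the lower spectral radius regarded as a
function on `D ⊆ M₂(ℝ)²`. -/

/-- Radius zero, continuity, no lower finiteness. -/
def U₁ (D : Set (Mat 2 × Mat 2)) : Set (Mat 2 × Mat 2) :=
  {p | p ∈ setPE ∧ lsr p = 0 ∧ ContinuousWithinAt lsr D p ∧ ¬ HasLFP p}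

/-- Radius zero, continuity, lower finiteness. -/
def U₂ (D : Set (Mat 2 × Mat 2)) : Set (Mat 2 × Mat 2) :=
  {p | p ∈ setPE ∧ lsr p = 0 ∧ ContinuousWithinAt lsr D p ∧ HasLFP p}

/-- Positive radius, discontinuity, no lower finiteness. -/
def U₃ (D : Set (Mat 2 × Mat 2)) : Set (Mat 2 × Mat 2) :=
  {p | p ∈ setPE ∧ 0 < lsr p ∧ ¬ ContinuousWithinAt lsr D p ∧ ¬ HasLFP p}

/-- Positive radius, discontinuity, lower finiteness. -/
def U₄ (D : Set (Mat 2 × Mat 2)) : Set (Mat 2 × Mat 2) :=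
  {p | p ∈ setPE ∧ 0 < lsr p ∧ ¬ ContinuousWithinAt lsr D p ∧ HasLFP p}

/-- `S ⊆ setPE` is dense in `setPE` for the subspace topology. -/
def DenseInPE (S : Set (Mat 2 × Mat 2)) : Prop :=
  Dense ((fun p : setPE => (p : Mat 2 × Mat 2)) ⁻¹' S)

/-- The eight entries of a pair of matrices, as a point of Euclidean `8`-space. -/
noncomputable def entries (p : Mat 2 × Mat 2) :
    EuclideanSpace ℝ ((Fin 2 × Fin 2) ⊕ (Fin 2 × Fin 2)) :=
  WithLp.toLp 2 (Sum.elim (fun ij => p.1 ij.1 ij.2) (fun ij => p.2 ij.1 ij.2))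

/-- `S` has full Lebesgue measure in the seven-dimensional submanifold `setPE` of
`M₂(ℝ)² = ℝ⁸`. The Lebesgue (surface) measure of a seven-dimensional submanifold of Euclidean
space is, up to a constant factor, the seven-dimensional Hausdorff measure. -/
def FullLebesgueMeasureInPE (S : Set (Mat 2 × Mat 2)) : Prop :=
  Measure.hausdorffMeasure 7 (entries '' (setPE \ S)) = 0

section
open scoped Matrix.Norms.L2Operator

theorem minGrowth_le {d : ℕ} {A : Set (Mat d)} {n : ℕ} {w : List (Mat d)}
    (hw : w ∈ words A n) : minGrowth A n ≤ ‖w.prod‖ ^ (1 / (n : ℝ)) := by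
  refine csInf_le ⟨0, ?_⟩ ⟨w, hw, rfl⟩
  rintro _ ⟨v, -, rfl⟩
  positivity

theorem minGrowth_nonneg {d : ℕ} (A : Set (Mat d)) (n : ℕ) : 0 ≤ minGrowth A n := by
  refine Real.sInf_nonneg ?_
  rintro _ ⟨v, -, rfl⟩
  positivity

/-- The limit defining the lower spectral radius exists. -/
theorem tendsto_minGrowth {d : ℕ} {A : Set (Mat d)} (hA : A.Nonempty) :
    Tendsto (minGrowth A) atTop (𝓝 (lowerSpectralRadius A)) := by
  obtain ⟨B, hB⟩ := hA
  refine tendsto_nhds_limUnder ?_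
  set S : Set ℝ := minGrowth A '' Ici 1 with hS
  have hSb : BddBelow S := ⟨0, by rintro _ ⟨n, -, rfl⟩; exact minGrowth_nonneg A n⟩
  have hSn : S.Nonempty := ⟨_, 1, by simp, rfl⟩
  refine ⟨sInf S, ?_⟩
  have hL0 : 0 ≤ sInf S := by
    refine Real.sInf_nonneg ?_
    rintro _ ⟨n, -, rfl⟩
    exact minGrowth_nonneg A n
  have key : ∀ c : ℝ, sInf S < c → ∃ K : ℝ, 0 < K ∧
      ∀ᶠ n : ℕ in atTop, minGrowth A n ≤ c * K ^ (1 / (n : ℝ)) := by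
    intro c hc
    have hc0 : 0 < c := hL0.trans_lt hc
    obtain ⟨_, ⟨m, hm, rfl⟩, hmc⟩ := exists_lt_of_csInf_lt hSn hc
    have hm1 : 1 ≤ m := hm
    have hne : ((fun w : List (Mat d) => ‖w.prod‖ ^ (1 / (m : ℝ))) '' words A m).Nonempty :=
      ⟨_, List.replicate m B, ⟨by simp, by simp +contextual [hB]⟩, rfl⟩
    obtain ⟨_, ⟨w, hw, rfl⟩, hwc⟩ := exists_lt_of_csInf_lt hne hmc
    have hWc : ‖w.prod‖ ≤ c ^ m := by
      have h1 := Real.rpow_le_rpow (by positivity) hwc.le (Nat.cast_nonneg m)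
      dsimp only at h1
      rw [← Real.rpow_mul (norm_nonneg _), one_div_mul_cancel (by positivity), Real.rpow_one,
        Real.rpow_natCast] at h1
      exact h1
    refine ⟨1 + ∑ r ∈ Finset.range m, ‖B ^ r‖ / c ^ r, by positivity, ?_⟩
    filter_upwards [eventually_ge_atTop m] with n hn
    have hn0 : 0 < n := by omega
    have hq : 0 < n / m := Nat.div_pos hn (by omega)
    have hr : n % m < m := Nat.mod_lt _ (by omega)
    have hword : (List.replicate (n / m) w).flatten ++ List.replicate (n % m) B ∈ words A n := by
      refine ⟨?_, ?_⟩
      · simp [hw.1]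
        exact Nat.div_add_mod' n m
      · intro X hX
        simp only [List.mem_append, List.mem_flatten, List.mem_replicate] at hX
        rcases hX with ⟨l, ⟨-, rfl⟩, hX⟩ | ⟨-, rfl⟩
        · exact hw.2 X hX
        · exact hB
    refine (minGrowth_le hword).trans ?_
    have hprod : ((List.replicate (n / m) w).flatten ++ List.replicate (n % m) B).prod
        = w.prod ^ (n / m) * B ^ (n % m) := by
      simp [List.prod_flatten]
    rw [hprod]
    have hterm : ‖B ^ (n % m)‖ / c ^ (n % m)
        ≤ 1 + ∑ r ∈ Finset.range m, ‖B ^ r‖ / c ^ r := by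
      have := Finset.single_le_sum (f := fun r => ‖B ^ r‖ / c ^ r)
        (fun i _ => by positivity) (Finset.mem_range.2 hr)
      linarith
    have hbound : ‖w.prod ^ (n / m) * B ^ (n % m)‖
        ≤ c ^ n * (1 + ∑ r ∈ Finset.range m, ‖B ^ r‖ / c ^ r) := by
      calc ‖w.prod ^ (n / m) * B ^ (n % m)‖
          ≤ ‖w.prod ^ (n / m)‖ * ‖B ^ (n % m)‖ := norm_mul_le _ _
        _ ≤ (c ^ m) ^ (n / m) * ‖B ^ (n % m)‖ := by
            gcongr
            exact (norm_pow_le' _ hq).trans (pow_le_pow_left₀ (norm_nonneg _) hWc _)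
        _ = c ^ n * (‖B ^ (n % m)‖ / c ^ (n % m)) := by
            have : c ^ n = (c ^ m) ^ (n / m) * c ^ (n % m) := by
              rw [← pow_mul, ← pow_add, Nat.div_add_mod]
            rw [this]
            field_simp
        _ ≤ _ := by gcongr
    refine (Real.rpow_le_rpow (norm_nonneg _) hbound (by positivity)).trans_eq ?_
    rw [Real.mul_rpow (by positivity) (by positivity), ← Real.rpow_natCast c n,
      ← Real.rpow_mul hc0.le, mul_one_div_cancel (by positivity), Real.rpow_one]
  refine tendsto_order.2 ⟨fun a ha => ?_, fun a ha => ?_⟩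
  · filter_upwards [eventually_ge_atTop 1] with n hn
    exact ha.trans_le (csInf_le hSb ⟨n, hn, rfl⟩)
  · obtain ⟨c, hc1, hc2⟩ := exists_between ha
    obtain ⟨K, hK, hev⟩ := key c hc1
    have hlim : Tendsto (fun n : ℕ => c * K ^ (1 / (n : ℝ))) atTop (𝓝 c) := by
      have h1 : Tendsto (fun n : ℕ => K ^ (1 / (n : ℝ))) atTop (𝓝 (K ^ (0 : ℝ))) :=
        (Real.continuousAt_const_rpow hK.ne').tendsto.comp tendsto_one_div_atTop_nhds_zero_nat
      simpa using h1.const_mul c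
    filter_upwards [hev, hlim.eventually (gt_mem_nhds hc2)] with n h1 h2
    exact h1.trans_lt h2

end

end LowerSpectral

/-!
Let `(A, B)` be a pair with `A` of rank one and not nilpotent, and `B` elliptic. Write
`B = r • exp (θ J)` with `r = √(det B)` and a complex structure `J`. Then `tr (A B ^ k)` equals
`r ^ k * C * cos (k θ + α)` with `C > 0`. As `A M A = tr (A M) • A`, a product of copies of `A` and
`B` that contains `A` collapses to a multiple of one of the matrices `B ^ i A B ^ j`, the coefficient being a product
of such traces. Hence the lower spectral radius is the infimum of `r` and of the numbers
`|tr (A B ^ k)| ^ (1 / (k + 1))` (`lsr_le_sqrt_det`, `lsr_pow_le`, `le_lsr`), and lower finiteness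
holds exactly when this infimum is attained (`not_hasLFP`, `hasLFP_of_eq_trace`,
`hasLFP_of_eq_sqrt_det`). What remains concerns the numbers `K |cos (k θ + α)|`, with `K = C / r`.

* Moving `θ` slightly makes one of the cosines vanish, so radius zero is dense
  (`exists_near_lsr_eq_zero`). As the lower spectral radius is nonnegative and upper semicontinuous
  (`isOpen_lsr_lt`), it is continuous precisely where it vanishes. Its zeros without lower finiteness
  are the points where all traces are nonzero and all inequalities `lsr < 1 / (n + 1)` hold, which
  is a dense `G_δ` by the Baire category theorem.
* If the cosines are bounded below by a multiple of `1 / (k + 1) ^ 2`, their roots tend to `1`, and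
  the infimum is positive and attained (`lsr_pos_and_hasLFP`). For fixed `θ` this holds for almost
  every `α` by summing the measures of the exceptional sets (`ae_exists_le_abs_cos`). By Fubini's
  theorem the exceptional set is null in the coordinates given by two global charts with domain
  `ℝ ^ 7`, and locally Lipschitz maps preserve nullity for the Hausdorff measure.
* For an infimum which is positive and not attained, consider the closure of the set of `(θ, α)` for
  which the infimum is greater than a given `l`. In this Baire space, the conditions "no root is
  equal to `l`" and "some root is smaller than `l + ε`" are open and dense (`exists_not_attained`).
  Density of the latter (`exists_marginSet_near`) is the main point. A change of `θ` of order `1 / N`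
  produces a near-resonance at the index `N` only: on the line where `N θ + α` is constant, the
  cosine of index `k` depends on `(k - N) θ`, and a measure estimate shows that some point of a very
  short segment avoids all resonances of large index `k ≠ N`, while the ones of small index are not
  affected by so small a change.
-/

namespace LowerSpectral

/-! ### Rank-one and elliptic matrices, spectral radius -/

theorem rank_le_one_of_det_eq_zero {M : Mat 2} (h : M.det = 0) :
    M.rank ≤ 1 := by
  have h1 : M.rank ≤ 2 := by simpa using M.rank_le_card_width
  have h2 : M.rank ≠ 2 := by
    intro h2
    have : LinearIndependent ℝ M.col := by
      rw [linearIndependent_iff_card_eq_finrank_span, Set.finrank, ← Matrix.rank_eq_finrank_span_cols,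
        h2]
      simp
    rw [Matrix.linearIndependent_cols_iff_isUnit, Matrix.isUnit_iff_isUnit_det, h] at this
    simp at this
  omega

theorem mem_setP_iff {M : Mat 2} : M ∈ setP ↔ M.det = 0 ∧ M.trace ≠ 0 := by
  constructor
  · rintro ⟨h1, h2⟩
    have hd : M.det = 0 := by
      by_contra hd
      have := Matrix.rank_of_det_ne_zero hd
      simp [h1] at this
    refine ⟨hd, fun ht => h2 ⟨2, ?_⟩⟩
    rw [Matrix.det_fin_two] at hd
    rw [Matrix.trace_fin_two] at ht
    have h3 : M 1 1 = - M 0 0 := by linarith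
    rw [h3] at hd
    ext i j
    fin_cases i <;> fin_cases j <;> simp [pow_two, Matrix.mul_apply, Fin.sum_univ_two, h3] <;>
      linarith
  · rintro ⟨h1, h2⟩
    refine ⟨le_antisymm (rank_le_one_of_det_eq_zero h1) ?_, fun h => h2 ?_⟩
    · rw [Nat.one_le_iff_ne_zero]
      intro h
      rw [Matrix.rank, Submodule.finrank_eq_zero, LinearMap.range_eq_bot] at h
      have h3 : M = 0 := by
        rwa [← Matrix.toLin'_apply', LinearEquiv.map_eq_zero_iff] at h
      simp [h3] at h2
    · exact (Matrix.isNilpotent_trace_of_isNilpotent h).eq_zero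

theorem mem_spectrum_iff {M : Mat 2} {z : ℂ} :
    z ∈ spectrum ℂ (M.map (algebraMap ℝ ℂ)) ↔ z ^ 2 - M.trace * z + M.det = 0 := by
  rw [Matrix.mem_spectrum_iff_isRoot_charpoly, Matrix.charpoly_fin_two]
  simp [Polynomial.IsRoot, Matrix.det_fin_two, Matrix.trace_fin_two]

theorem mem_setE_iff {M : Mat 2} : M ∈ setE ↔ M.trace ^ 2 < 4 * M.det := by
  constructor
  · intro h
    by_contra! hd
    have hs := Real.sq_sqrt (sub_nonneg.2 hd)
    set s := Real.sqrt (M.trace ^ 2 - 4 * M.det)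
    refine h (((M.trace + s) / 2 : ℝ) : ℂ) ?_ (Complex.ofReal_im _)
    rw [mem_spectrum_iff]
    norm_cast
    linarith
  · intro h z hz him
    rw [mem_spectrum_iff] at hz
    have hz' : z = (z.re : ℂ) := by
      apply Complex.ext <;> simp [him]
    rw [hz'] at hz
    norm_cast at hz
    nlinarith [sq_nonneg (2 * z.re - M.trace)]

theorem le_rho {d : ℕ} {M : Mat d} {z : ℂ} (hz : z ∈ spectrum ℂ (M.map (algebraMap ℝ ℂ))) :
    ‖z‖ ≤ rho M := by
  have hfin : spectralRadius ℂ (M.map (algebraMap ℝ ℂ)) ≠ ⊤ := by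
    let := Matrix.linftyOpNormedRing (n := Fin d) (α := ℂ)
    let := Matrix.linftyOpNormedAlgebra (n := Fin d) (R := ℂ) (α := ℂ)
    rcases isEmpty_or_nonempty (Fin d) with h | h
    · have : Subsingleton (Matrix (Fin d) (Fin d) ℂ) := inferInstance
      rw [spectrum.SpectralRadius.of_subsingleton]
      simp
    · exact ((spectrum.spectralRadius_le_nnnorm _).trans_lt ENNReal.coe_lt_top).ne
  have : (‖z‖₊ : ℝ≥0∞) ≤ spectralRadius ℂ (M.map (algebraMap ℝ ℂ)) :=
    le_iSup₂ (f := fun k (_ : k ∈ spectrum ℂ (M.map (algebraMap ℝ ℂ))) => (‖k‖₊ : ℝ≥0∞)) z hz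
  simpa [rho] using ENNReal.toReal_mono hfin this

theorem rho_le {d : ℕ} {M : Mat d} {R : ℝ} (hR : 0 ≤ R)
    (h : ∀ z ∈ spectrum ℂ (M.map (algebraMap ℝ ℂ)), ‖z‖ ≤ R) : rho M ≤ R := by
  refine ENNReal.toReal_le_of_le_ofReal hR (iSup₂_le fun z hz => ?_)
  rw [← ENNReal.ofReal_coe_nnreal]
  exact ENNReal.ofReal_le_ofReal (h z hz)

/-- The eigenvalues of a singular matrix are zero and the trace. -/
theorem abs_trace_le_rho {M : Mat 2} (h : M.det = 0) : |M.trace| ≤ rho M := by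
  have : (M.trace : ℂ) ∈ spectrum ℂ (M.map (algebraMap ℝ ℂ)) := by
    rw [mem_spectrum_iff, h]
    push_cast
    ring
  simpa using le_rho this

theorem rho_eq_abs_trace {M : Mat 2} (h : M.det = 0) : rho M = |M.trace| := by
  refine le_antisymm (rho_le (abs_nonneg _) fun z hz => ?_) (abs_trace_le_rho h)
  rw [mem_spectrum_iff, h] at hz
  have hz' : z * (z - M.trace) = 0 := by
    push_cast at hz
    linear_combination hz
  rcases mul_eq_zero.1 hz' with h0 | h0
  · simp [h0]
  · rw [sub_eq_zero.1 h0]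
    simp

/-- The two eigenvalues of an elliptic matrix are complex conjugate, so that their common
modulus is the square root of the determinant. -/
theorem norm_eq_sqrt_det {M : Mat 2} (hM : M ∈ setE) {z : ℂ}
    (hz : z ∈ spectrum ℂ (M.map (algebraMap ℝ ℂ))) : ‖z‖ = √M.det := by
  have him := hM z hz
  rw [mem_spectrum_iff] at hz
  have h1 := congrArg Complex.im hz
  have h2 := congrArg Complex.re hz
  simp [pow_two] at h1 h2
  have h3 : z.re * 2 = M.trace := by
    have : z.im * (z.re * 2 - M.trace) = 0 := by linarith
    rcases mul_eq_zero.1 this with h | h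
    · exact absurd h him
    · linarith
  rw [Complex.norm_def, Complex.normSq_apply]
  congr 1
  rw [← h3] at h2
  linarith

theorem rho_eq_sqrt_det {M : Mat 2} (hM : M ∈ setE) : rho M = √M.det := by
  refine le_antisymm (rho_le (Real.sqrt_nonneg _) fun z hz => (norm_eq_sqrt_det hM hz).le) ?_
  obtain ⟨z, hz⟩ := spectrum.nonempty_of_isAlgClosed_of_finiteDimensional ℂ
    (M.map (algebraMap ℝ ℂ))
  rw [← norm_eq_sqrt_det hM hz]
  exact le_rho hz

theorem sqrt_det_pow_le_rho_pow {M : Mat 2} (hM : M ∈ setE) (n : ℕ) :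
    √M.det ^ n ≤ rho (M ^ n) := by
  obtain ⟨z, hz⟩ := spectrum.nonempty_of_isAlgClosed_of_finiteDimensional ℂ
    (M.map (algebraMap ℝ ℂ))
  rw [← norm_eq_sqrt_det hM hz, ← norm_pow]
  apply le_rho
  have := spectrum.pow_mem_pow _ n hz
  rwa [← Matrix.map_pow] at this

/-- The compression identity behind every computation with products containing the
rank-one matrix. -/
theorem mul_mul_self_of_det_eq_zero {A : Mat 2} (h : A.det = 0) (M : Mat 2) :
    A * M * A = (A * M).trace • A := by
  rw [Matrix.det_fin_two] at h
  have h' : A 0 0 * A 1 1 = A 0 1 * A 1 0 := by linarith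
  ext i j
  fin_cases i <;> fin_cases j <;>
    simp [Matrix.mul_apply, Fin.sum_univ_two, Matrix.trace_fin_two]
  · linear_combination (- M 1 1) * h'
  · linear_combination (M 0 1) * h'
  · linear_combination (M 1 0) * h'
  · linear_combination (- M 0 0) * h'

/-! ### The rotation group of an elliptic matrix -/

/-- The one-parameter group `exp (t J)`, for `J` a complex structure (`J ^ 2 = -1`). -/
noncomputable def rot (J : Mat 2) (t : ℝ) : Mat 2 := Real.cos t • (1 : Mat 2) + Real.sin t • J

theorem rot_zero (J : Mat 2) : rot J 0 = 1 := by simp [rot]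

theorem rot_mul_rot {J : Mat 2} (hJ : J * J = -1) (s t : ℝ) :
    rot J s * rot J t = rot J (s + t) := by
  simp only [rot, add_mul, mul_add, smul_mul_assoc, mul_smul_comm, one_mul, mul_one, hJ,
    Real.cos_add, Real.sin_add]
  module

theorem smul_rot_pow {J : Mat 2} (hJ : J * J = -1) (r t : ℝ) (k : ℕ) :
    (r • rot J t) ^ k = r ^ k • rot J (k * t) := by
  induction k with
  | zero => simp [rot_zero]
  | succ k ih =>
    rw [pow_succ, ih, smul_mul_smul_comm, rot_mul_rot hJ, pow_succ]
    congr 2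
    push_cast
    ring

theorem continuous_rot (J : Mat 2) : Continuous (rot J) := by
  unfold rot
  fun_prop

theorem trace_eq_zero_and_det_eq_one {J : Mat 2} (hJ : J * J = -1) : J.trace = 0 ∧ J.det = 1 := by
  have h00 := congrFun (congrFun hJ 0) 0
  have h01 := congrFun (congrFun hJ 0) 1
  have h10 := congrFun (congrFun hJ 1) 0
  simp [Matrix.mul_apply, Fin.sum_univ_two] at h00 h01 h10
  have ht : J.trace = 0 := by
    rw [Matrix.trace_fin_two]
    by_contra h
    have : J 0 1 = 0 := by
      have : J 0 1 * (J 0 0 + J 1 1) = 0 := by linarith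
      rcases mul_eq_zero.1 this with h' | h'
      · exact h'
      · exact absurd h' h
    rw [this] at h00
    nlinarith [sq_nonneg (J 0 0)]
  refine ⟨ht, ?_⟩
  rw [Matrix.trace_fin_two] at ht
  rw [Matrix.det_fin_two]
  have : J 1 1 = - J 0 0 := by linarith
  rw [this]
  linarith

theorem exists_polar (a b : ℝ) : ∃ r t : ℝ, 0 ≤ r ∧ a = r * Real.cos t ∧ b = r * Real.sin t :=
  ⟨‖(⟨a, b⟩ : ℂ)‖, Complex.arg ⟨a, b⟩, norm_nonneg _,
    (Complex.norm_mul_cos_arg ⟨a, b⟩).symm, (Complex.norm_mul_sin_arg ⟨a, b⟩).symm⟩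

theorem det_smul_rot {J : Mat 2} (hJ : J * J = -1) (r t : ℝ) : (r • rot J t).det = r ^ 2 := by
  obtain ⟨h1, h2⟩ := trace_eq_zero_and_det_eq_one hJ
  rw [Matrix.trace_fin_two] at h1
  rw [Matrix.det_fin_two] at h2
  simp [Matrix.det_fin_two, rot]
  have := Real.sin_sq_add_cos_sq t
  linear_combination r ^ 2 * (Real.cos t * Real.sin t) * h1 + r ^ 2 * Real.sin t ^ 2 * h2
    + r ^ 2 * this

theorem trace_smul_rot {J : Mat 2} (hJ : J * J = -1) (r t : ℝ) :
    (r • rot J t).trace = 2 * r * Real.cos t := by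
  have h1 := (trace_eq_zero_and_det_eq_one hJ).1
  simp [rot, h1]
  ring

theorem smul_rot_mem_setE_iff {J : Mat 2} (hJ : J * J = -1) (r t : ℝ) :
    r • rot J t ∈ setE ↔ r * Real.sin t ≠ 0 := by
  rw [mem_setE_iff, det_smul_rot hJ, trace_smul_rot hJ]
  have h := Real.sin_sq_add_cos_sq t
  have h2 : 4 * r ^ 2 - (2 * r * Real.cos t) ^ 2 = (2 * (r * Real.sin t)) ^ 2 := by
    linear_combination (-4 * r ^ 2) * h
  rw [← sub_pos, h2, sq_pos_iff]
  simp

/-- An elliptic matrix is a positive multiple of a rotation for some complex structure `J`. The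
sign of `J` can be prescribed by that of its upper right entry. -/
theorem exists_eq_smul_rot {M : Mat 2} (hM : M ∈ setE) :
    ∃ (J : Mat 2) (r t : ℝ), J * J = -1 ∧ 0 < J 0 1 ∧ 0 < r ∧ M = r • rot J t := by
  rw [mem_setE_iff, Matrix.trace_fin_two, Matrix.det_fin_two] at hM
  have hb : 0 < M 0 0 * M 1 1 - M 0 1 * M 1 0 - ((M 0 0 + M 1 1) / 2) ^ 2 := by linarith
  have h01 : M 0 1 ≠ 0 := by
    intro h
    rw [h] at hb
    nlinarith [sq_nonneg (M 0 0 - M 1 1)]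
  obtain ⟨b, hb2, hb1⟩ : ∃ b : ℝ,
      b ^ 2 = M 0 0 * M 1 1 - M 0 1 * M 1 0 - ((M 0 0 + M 1 1) / 2) ^ 2 ∧ 0 < M 0 1 / b := by
    have hs := Real.sq_sqrt hb.le
    have hs' := Real.sqrt_pos.2 hb
    rcases lt_or_gt_of_ne h01 with h | h
    · exact ⟨-√_, by rw [neg_sq, hs], div_pos_of_neg_of_neg h (by linarith)⟩
    · exact ⟨_, hs, div_pos h hs'⟩
  have hb0 : b ≠ 0 := by
    rintro rfl
    simp at hb1
  obtain ⟨r, t, hr, hc, hs⟩ := exists_polar ((M 0 0 + M 1 1) / 2) b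
  refine ⟨b⁻¹ • (M - ((M 0 0 + M 1 1) / 2) • 1), r, t, ?_, ?_, ?_, ?_⟩
  · ext i j
    fin_cases i <;> fin_cases j <;>
      simp [Matrix.mul_apply, Fin.sum_univ_two] <;> field_simp <;>
      first | ring1 | linear_combination 4 * hb2
  · simpa [div_eq_inv_mul] using hb1
  · refine lt_of_le_of_ne hr ?_
    rintro rfl
    simp at hs
    exact hb0 hs
  · rw [rot, smul_add, smul_smul, smul_smul, ← hc, ← hs, smul_inv_smul₀ hb0]
    abel

/-! ### Bounds for the lower spectral radius -/

theorem replicate_flatten_mem_words {d : ℕ} {A : Set (Mat d)} {n : ℕ} {w : List (Mat d)}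
    (hw : w ∈ words A n) (m : ℕ) : (List.replicate m w).flatten ∈ words A (n * m) := by
  refine ⟨by simp [hw.1, mul_comm], fun X hX => ?_⟩
  simp only [List.mem_flatten, List.mem_replicate] at hX
  obtain ⟨l, ⟨-, rfl⟩, hX⟩ := hX
  exact hw.2 X hX

theorem nonempty_of_mem_words {d : ℕ} {A : Set (Mat d)} {n : ℕ} {w : List (Mat d)}
    (hn : 1 ≤ n) (hw : w ∈ words A n) : A.Nonempty := by
  rcases w with _ | ⟨X, w⟩
  · have := hw.1
    simp at this
    omega
  · exact ⟨X, hw.2 X (by simp)⟩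

theorem lowerSpectralRadius_nonneg {d : ℕ} {A : Set (Mat d)} (hA : A.Nonempty) :
    0 ≤ lowerSpectralRadius A :=
  ge_of_tendsto' (tendsto_minGrowth hA) (minGrowth_nonneg A)

theorem lsr_nonneg (p : Mat 2 × Mat 2) : 0 ≤ lsr p :=
  lowerSpectralRadius_nonneg (insert_nonempty _ _)

theorem tendsto_const_rpow_inv_mul {C : ℝ} (hC : 0 < C) (R : ℝ) :
    Tendsto (fun n : ℕ => C ^ (1 / (n : ℝ)) * R) atTop (𝓝 R) := by
  have h1 : Tendsto (fun n : ℕ => C ^ (1 / (n : ℝ))) atTop (𝓝 (C ^ (0 : ℝ))) :=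
    (Real.continuousAt_const_rpow hC.ne').tendsto.comp tendsto_one_div_atTop_nhds_zero_nat
  simpa using h1.mul_const R

section
open scoped Matrix.Norms.L2Operator

/-- Bounding the growth of the powers of a single product bounds the lower spectral radius. -/
theorem lowerSpectralRadius_le_of_pow {d : ℕ} {A : Set (Mat d)} {n : ℕ} {w : List (Mat d)}
    (hn : 1 ≤ n) (hw : w ∈ words A n) {C R : ℝ} (hC : 0 < C) (hR : 0 ≤ R)
    (h : ∀ m : ℕ, ‖w.prod ^ (m + 2)‖ ≤ C * (R ^ n) ^ (m + 2)) :
    lowerSpectralRadius A ≤ R := by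
  have hsub : Tendsto (fun m : ℕ => n * (m + 2)) atTop atTop :=
    (tendsto_add_atTop_nat 2).const_mul_atTop' (by omega)
  refine le_of_tendsto_of_tendsto'
    ((tendsto_minGrowth (nonempty_of_mem_words hn hw)).comp hsub)
    ((tendsto_const_rpow_inv_mul hC R).comp hsub) fun m => ?_
  have h0 : n * (m + 2) ≠ 0 := by positivity
  refine (minGrowth_le (replicate_flatten_mem_words hw (m + 2))).trans ?_
  have hprod : (List.replicate (m + 2) w).flatten.prod = w.prod ^ (m + 2) := by
    simp [List.prod_flatten]
  rw [hprod]
  refine (Real.rpow_le_rpow (norm_nonneg _) (h m) (by positivity)).trans_eq ?_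
  rw [← pow_mul, Real.mul_rpow hC.le (by positivity), one_div ((n * (m + 2) : ℕ) : ℝ),
    Real.pow_rpow_inv_natCast hR h0]
  simp

theorem lowerSpectralRadius_le_norm {d : ℕ} {A : Set (Mat d)} {n : ℕ} {w : List (Mat d)}
    (hn : 1 ≤ n) (hw : w ∈ words A n) :
    lowerSpectralRadius A ≤ ‖w.prod‖ ^ (1 / (n : ℝ)) := by
  refine lowerSpectralRadius_le_of_pow hn hw one_pos (by positivity) fun m => ?_
  rw [one_div, Real.rpow_inv_natCast_pow (norm_nonneg _) (by omega), one_mul]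
  exact norm_pow_le' _ (by omega)

theorem norm_rot_le (J : Mat 2) (t : ℝ) : ‖rot J t‖ ≤ ‖(1 : Mat 2)‖ + ‖J‖ := by
  refine (norm_add_le _ _).trans (add_le_add ?_ ?_)
  · rw [norm_smul]
    exact mul_le_of_le_one_left (norm_nonneg _) (Real.abs_cos_le_one t)
  · rw [norm_smul]
    exact mul_le_of_le_one_left (norm_nonneg _) (Real.abs_sin_le_one t)

theorem sqrt_det_smul_rot {J : Mat 2} (hJ : J * J = -1) {r : ℝ} (hr : 0 < r) (t : ℝ) :
    √(r • rot J t).det = r := by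
  rw [det_smul_rot hJ, Real.sqrt_sq hr.le]

theorem lsr_le_sqrt_det {p : Mat 2 × Mat 2} (hp : p ∈ setPE) : lsr p ≤ √p.2.det := by
  obtain ⟨J, r, t, hJ, -, hr, h⟩ := exists_eq_smul_rot hp.2
  rw [h, sqrt_det_smul_rot hJ hr]
  have hw : [p.2] ∈ words {p.1, p.2} 1 := by simp [words]
  refine lowerSpectralRadius_le_of_pow le_rfl hw (C := 1 + (‖(1 : Mat 2)‖ + ‖J‖))
    (by positivity) hr.le fun m => ?_
  rw [List.prod_singleton, h, smul_rot_pow hJ, norm_smul, pow_one, norm_pow, Real.norm_eq_abs,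
    abs_of_pos hr, mul_comm]
  have := norm_rot_le J ((m + 2 : ℕ) * t)
  gcongr
  linarith

theorem cons_replicate_mem_words (A B : Mat 2) (k : ℕ) :
    A :: List.replicate k B ∈ words {A, B} (k + 1) := by
  refine ⟨by simp, fun X hX => ?_⟩
  simp only [List.mem_cons, List.mem_replicate] at hX
  rcases hX with h | ⟨-, h⟩ <;> simp [h]

theorem mul_pow_succ_of_det_eq_zero {A : Mat 2} (h : A.det = 0) (M : Mat 2) (m : ℕ) :
    (A * M) ^ (m + 1) = (A * M).trace ^ m • (A * M) := by
  induction m with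
  | zero => simp
  | succ m ih =>
    rw [pow_succ, ih, smul_mul_assoc, ← mul_assoc, mul_mul_self_of_det_eq_zero h, smul_mul_assoc,
      smul_smul, pow_succ]

theorem lsr_pow_le {p : Mat 2 × Mat 2} (hp : p ∈ setPE) (k : ℕ) :
    lsr p ^ (k + 1) ≤ |(p.1 * p.2 ^ k).trace| := by
  have hd := (mem_setP_iff.1 hp.1).1
  set τ := (p.1 * p.2 ^ k).trace with hτ
  have key : lsr p ≤ |τ| ^ (1 / ((k + 1 : ℕ) : ℝ)) := by
    refine lowerSpectralRadius_le_of_pow (by omega) (cons_replicate_mem_words p.1 p.2 k)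
      (C := 1 + ‖p.1 * p.2 ^ k‖ / |τ|) (by positivity) (by positivity) fun m => ?_
    rw [one_div, Real.rpow_inv_natCast_pow (abs_nonneg _) (by omega), List.prod_cons,
      List.prod_replicate, mul_pow_succ_of_det_eq_zero hd, ← hτ, norm_smul, norm_pow,
      Real.norm_eq_abs]
    by_cases h0 : τ = 0
    · simp [h0]
    · have h1 : 0 < |τ| := abs_pos.2 h0
      have h2 : (1 + ‖p.1 * p.2 ^ k‖ / |τ|) * |τ| ^ (m + 2)
          = |τ| ^ (m + 1) * (|τ| + ‖p.1 * p.2 ^ k‖) := by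
        field_simp
        ring
      rw [h2]
      gcongr
      linarith
  refine (pow_le_pow_left₀ (lsr_nonneg p) key _).trans_eq ?_
  rw [one_div, Real.rpow_inv_natCast_pow (abs_nonneg _) (by omega)]

/-- Multiplying `A` by a product of copies of `A` and `B` collapses, since `A` has rank one, to a
multiple of `B ^ k * A`, and the coefficient is a product of traces of matrices `A * B ^ j`. -/
theorem exists_prod_mul_eq {A B : Mat 2} (hA : A.det = 0) {l : ℝ} (hl : 0 ≤ l)
    (h : ∀ k : ℕ, l ^ (k + 1) ≤ |(A * B ^ k).trace|) (h0 : ∀ k : ℕ, (A * B ^ k).trace ≠ 0)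
    (w : List (Mat 2)) (hw : ∀ X ∈ w, X ∈ ({A, B} : Set (Mat 2))) :
    ∃ (k : ℕ) (c : ℝ), k ≤ w.length ∧ c ≠ 0 ∧ l ^ (w.length - k) ≤ |c| ∧
      w.prod * A = c • (B ^ k * A) := by
  induction w with
  | nil => exact ⟨0, 1, by simp⟩
  | cons X w ih =>
    obtain ⟨k, c, hk, hc0, hc, hw'⟩ := ih fun Y hY => hw Y (by simp [hY])
    rcases hw X (by simp) with rfl | rfl
    · refine ⟨0, c * (X * B ^ k).trace, by simp, mul_ne_zero hc0 (h0 k), ?_, ?_⟩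
      · have : (X :: w).length - 0 = (w.length - k) + (k + 1) := by
          simp
          omega
        rw [this, pow_add, abs_mul]
        gcongr
        exact h k
      · rw [List.prod_cons, mul_assoc, hw', mul_smul_comm, ← mul_assoc,
          mul_mul_self_of_det_eq_zero hA, smul_smul]
        simp
    · refine ⟨k + 1, c, by simpa using hk, hc0, ?_, ?_⟩
      · have : (X :: w).length - (k + 1) = w.length - k := by simp
        rwa [this]
      · rw [List.prod_cons, mul_assoc, hw', mul_smul_comm, ← mul_assoc, pow_succ']

/-- Together with `lsr_le_sqrt_det` and `lsr_pow_le`, this computes the lower spectral radius on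
`setPE`: every product of length `n` has norm at least a constant times `l ^ n`. -/
theorem le_lsr {p : Mat 2 × Mat 2} (hp : p ∈ setPE) {l : ℝ} (hl : l ≤ √p.2.det)
    (h : ∀ k : ℕ, l ^ (k + 1) ≤ |(p.1 * p.2 ^ k).trace|) : l ≤ lsr p := by
  rcases le_or_gt l 0 with h0 | h0
  · exact h0.trans (lsr_nonneg p)
  have htr : ∀ k : ℕ, (p.1 * p.2 ^ k).trace ≠ 0 := fun k hk => by
    have := h k
    rw [hk, abs_zero] at this
    exact absurd this (not_le.2 (pow_pos h0 _))
  obtain ⟨hd, ht⟩ := mem_setP_iff.1 hp.1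
  obtain ⟨J, r, t, hJ, -, hr, hB⟩ := exists_eq_smul_rot hp.2
  rw [hB, sqrt_det_smul_rot hJ hr] at hl
  have hA : 0 < ‖p.1‖ := by
    rw [norm_pos_iff]
    rintro h
    simp [h] at ht
  have hone : 0 < ‖(1 : Mat 2)‖ := norm_pos_iff.2 one_ne_zero
  set D : ℝ := ‖(1 : Mat 2)‖ + ‖J‖ with hD
  have hD0 : 0 < D := by positivity
  have hword : ∀ w : List (Mat 2), (∀ X ∈ w, X ∈ ({p.1, p.2} : Set (Mat 2))) →
      D⁻¹ * l ^ w.length ≤ ‖w.prod‖ := by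
    intro w hw
    obtain ⟨k, c, hk, -, hc, hwp⟩ := exists_prod_mul_eq hd h0.le h htr w hw
    have h1 : r ^ k * ‖p.1‖ ≤ D * ‖p.2 ^ k * p.1‖ := by
      have : r ^ k • p.1 = rot J (-(k * t)) * (p.2 ^ k * p.1) := by
        rw [hB, smul_rot_pow hJ, smul_mul_assoc, mul_smul_comm, ← mul_assoc, rot_mul_rot hJ,
          neg_add_cancel, rot_zero, one_mul]
      calc r ^ k * ‖p.1‖ = ‖r ^ k • p.1‖ := by
            rw [norm_smul, norm_pow, Real.norm_eq_abs, abs_of_pos hr]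
        _ ≤ ‖rot J (-(k * t))‖ * ‖p.2 ^ k * p.1‖ := by
            rw [this]
            exact norm_mul_le _ _
        _ ≤ _ := by
            gcongr
            exact norm_rot_le _ _
    have h2 : |c| * ‖p.2 ^ k * p.1‖ ≤ ‖w.prod‖ * ‖p.1‖ := by
      rw [← Real.norm_eq_abs, ← norm_smul, ← hwp]
      exact norm_mul_le _ _
    have h3 : l ^ w.length = l ^ (w.length - k) * l ^ k := by
      rw [← pow_add, Nat.sub_add_cancel hk]
    have h4 : l ^ w.length * ‖p.1‖ ≤ (D * ‖w.prod‖) * ‖p.1‖ := by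
      calc l ^ w.length * ‖p.1‖ = l ^ (w.length - k) * (l ^ k * ‖p.1‖) := by rw [h3]; ring
        _ ≤ |c| * (D * ‖p.2 ^ k * p.1‖) := by
            have : l ^ k * ‖p.1‖ ≤ r ^ k * ‖p.1‖ := by gcongr
            exact mul_le_mul hc (this.trans h1) (by positivity) (abs_nonneg _)
        _ = D * (|c| * ‖p.2 ^ k * p.1‖) := by ring
        _ ≤ D * (‖w.prod‖ * ‖p.1‖) := by gcongr
        _ = _ := by ring
    rw [inv_mul_le_iff₀ hD0]
    exact le_of_mul_le_mul_right h4 hA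
  refine le_of_tendsto_of_tendsto (tendsto_const_rpow_inv_mul (inv_pos.2 hD0) l)
    (tendsto_minGrowth (insert_nonempty _ _)) ?_
  filter_upwards [eventually_ge_atTop 1] with n hn
  refine le_csInf ⟨_, List.replicate n p.2, ⟨by simp, by simp +contextual⟩, rfl⟩ ?_
  rintro _ ⟨w, hw, rfl⟩
  refine Eq.trans_le ?_ (Real.rpow_le_rpow (by positivity) (hword w hw.2) (by positivity))
  rw [hw.1, Real.mul_rpow (by positivity) (by positivity), one_div (n : ℝ),
    Real.pow_rpow_inv_natCast h0.le (by omega)]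

/-- If `l` is a strict lower bound for the spectral radii of `B` and of all `A * B ^ k`, suitably
normalized, then it is one for all products: a product containing `A` is singular, and its trace is
up to sign a product of traces of matrices `A * B ^ k`. -/
theorem lt_rho_prod {p : Mat 2 × Mat 2} (hp : p ∈ setPE) {l : ℝ} (hl0 : 0 ≤ l)
    (hl : l < √p.2.det) (h : ∀ k : ℕ, l ^ (k + 1) < |(p.1 * p.2 ^ k).trace|)
    {n : ℕ} (hn : 1 ≤ n) {w : List (Mat 2)} (hw : w ∈ words {p.1, p.2} n) :
    l ^ n < rho w.prod := by
  have htr : ∀ k : ℕ, (p.1 * p.2 ^ k).trace ≠ 0 := fun k =>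
    abs_pos.1 ((pow_nonneg hl0 _).trans_lt (h k))
  have hd := (mem_setP_iff.1 hp.1).1
  obtain ⟨hlen, hw⟩ := hw
  by_cases hmem : p.1 ∈ w
  · obtain ⟨x, y, rfl⟩ := List.append_of_mem hmem
    have hdet : (x ++ p.1 :: y).prod.det = 0 := by simp [hd]
    refine lt_of_lt_of_le ?_ (abs_trace_le_rho hdet)
    obtain ⟨k, c, hk, hc0, hc, hc'⟩ := exists_prod_mul_eq hd hl0 (fun k => (h k).le) htr (y ++ x)
      (fun X hX => hw X (by simp at hX ⊢; tauto))
    have : (x ++ p.1 :: y).prod.trace = c * (p.1 * p.2 ^ k).trace := by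
      rw [List.prod_append, List.prod_cons, ← mul_assoc, Matrix.trace_mul_comm, ← mul_assoc,
        ← List.prod_append, hc', Matrix.trace_smul, Matrix.trace_mul_comm, smul_eq_mul]
    rw [this, abs_mul]
    have hn' : n = ((y ++ x).length - k) + (k + 1) := by
      simp at hlen hk ⊢
      omega
    rw [hn', pow_add]
    exact mul_lt_mul' hc (h k) (by positivity) (abs_pos.2 hc0)
  · have hrep : w = List.replicate n p.2 := by
      refine List.eq_replicate_iff.2 ⟨hlen, fun X hX => ?_⟩
      rcases hw X hX with rfl | h
      · exact absurd hX hmem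
      · exact h
    rw [hrep, List.prod_replicate]
    exact (pow_lt_pow_left₀ hl hl0 (by omega)).trans_le (sqrt_det_pow_le_rho_pow hp.2 n)

theorem pow_eq_rho_of_eq_rpow {x : ℝ} {n : ℕ} {M : Mat 2} (hn : 1 ≤ n)
    (h : x = rho M ^ (1 / (n : ℝ))) : x ^ n = rho M := by
  rw [h, one_div, Real.rpow_inv_natCast_pow (show 0 ≤ rho M from ENNReal.toReal_nonneg) (by omega)]

theorem not_hasLFP {p : Mat 2 × Mat 2} (hp : p ∈ setPE) (hl : lsr p < √p.2.det)
    (h : ∀ k : ℕ, lsr p ^ (k + 1) < |(p.1 * p.2 ^ k).trace|) : ¬ HasLFP p := by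
  rintro ⟨n, hn, w, hw, hlw⟩
  exact (lt_rho_prod hp (lsr_nonneg p) hl h hn hw).ne (pow_eq_rho_of_eq_rpow hn hlw)

theorem hasLFP_of_eq_trace {p : Mat 2 × Mat 2} (hp : p ∈ setPE) {k : ℕ}
    (h : lsr p ^ (k + 1) = |(p.1 * p.2 ^ k).trace|) : HasLFP p := by
  refine ⟨k + 1, by omega, _, cons_replicate_mem_words p.1 p.2 k, ?_⟩
  have hd : (p.1 * p.2 ^ k).det = 0 := by simp [(mem_setP_iff.1 hp.1).1]
  rw [List.prod_cons, List.prod_replicate, rho_eq_abs_trace hd, ← h, one_div,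
    Real.pow_rpow_inv_natCast (lsr_nonneg p) (by omega)]
  rfl

theorem hasLFP_of_eq_sqrt_det {p : Mat 2 × Mat 2} (hp : p ∈ setPE) (h : lsr p = √p.2.det) :
    HasLFP p := by
  refine ⟨1, le_rfl, [p.2], by simp [words], ?_⟩
  rw [List.prod_singleton, rho_eq_sqrt_det hp.2, ← h]
  simp [lsr]

theorem sqrt_det_pos {M : Mat 2} (hM : M ∈ setE) : 0 < √M.det := by
  rw [Real.sqrt_pos]
  have := mem_setE_iff.1 hM
  nlinarith [sq_nonneg M.trace]

/-- A lower bound decaying only polynomially (relative to the modulus of the eigenvalues) for the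
traces makes `n`-th roots of the traces tend to the modulus, so that their minimum exists. -/
theorem lsr_pos_and_hasLFP {p : Mat 2 × Mat 2} (hp : p ∈ setPE) {c : ℝ} (hc : 0 < c)
    (h : ∀ k : ℕ, c * √p.2.det ^ k / (k + 1) ^ 2 ≤ |(p.1 * p.2 ^ k).trace|) :
    0 < lsr p ∧ HasLFP p := by
  have hr := sqrt_det_pos hp.2
  set r := √p.2.det with hr_def
  constructor
  · refine (lt_min hc (div_pos hr (by norm_num : (0 : ℝ) < 4))).trans_le
      (le_lsr hp ((min_le_right _ _).trans (by rw [← hr_def]; linarith)) fun k => ?_)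
    refine le_trans ?_ (h k)
    have h4 : ((k : ℝ) + 1) ^ 2 ≤ 4 ^ k := by
      have h5 : ((k : ℝ) + 1) ≤ 2 ^ k := by
        exact_mod_cast Nat.lt_two_pow_self
      calc ((k : ℝ) + 1) ^ 2 ≤ (2 ^ k) ^ 2 := by gcongr
        _ = 4 ^ k := by rw [← pow_mul, mul_comm, pow_mul]; norm_num
    calc min c (r / 4) ^ (k + 1) = min c (r / 4) ^ k * min c (r / 4) := pow_succ _ _
      _ ≤ (r / 4) ^ k * c := by
          gcongr
          · exact min_le_right _ _
          · exact min_le_left _ _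
      _ = c * r ^ k / 4 ^ k := by rw [div_pow]; ring
      _ ≤ _ := by gcongr
  · by_cases hall : ∀ k : ℕ, r ^ (k + 1) ≤ |(p.1 * p.2 ^ k).trace|
    · exact hasLFP_of_eq_sqrt_det hp (le_antisymm (lsr_le_sqrt_det hp) (le_lsr hp le_rfl hall))
    push Not at hall
    obtain ⟨k₀, hk₀⟩ := hall
    set g : ℕ → ℝ := fun k => |(p.1 * p.2 ^ k).trace| ^ (((k + 1 : ℕ) : ℝ)⁻¹) with hg
    have hgpow : ∀ k, g k ^ (k + 1) = |(p.1 * p.2 ^ k).trace| := fun k =>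
      Real.rpow_inv_natCast_pow (abs_nonneg _) (by omega)
    have hg0 : ∀ k, 0 ≤ g k := fun k => by positivity
    have hgr : g k₀ < r := lt_of_pow_lt_pow_left₀ (k₀ + 1) hr.le (by rwa [hgpow])
    have hev : ∀ᶠ k : ℕ in atTop, g k₀ ^ (k + 1) ≤ |(p.1 * p.2 ^ k).trace| := by
      have hlim : Tendsto (fun k : ℕ => ((k + 1 : ℕ) : ℝ) ^ 2 * (g k₀ / r) ^ (k + 1)) atTop (𝓝 0) :=
        (tendsto_pow_const_mul_const_pow_of_lt_one 2 (by have := hg0 k₀; positivity)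
          ((div_lt_one hr).2 hgr)).comp (tendsto_add_atTop_nat 1)
      filter_upwards [hlim.eventually (gt_mem_nhds (div_pos hc hr))] with k hk
      refine le_trans ?_ (h k)
      rw [le_div_iff₀ (by positivity)]
      rw [div_pow, lt_div_iff₀ hr, pow_succ r] at hk
      push_cast at hk
      have : ((k : ℝ) + 1) ^ 2 * (g k₀ ^ (k + 1) / (r ^ k * r)) * r
          = (g k₀ ^ (k + 1) * ((k : ℝ) + 1) ^ 2) / r ^ k := by
        field_simp
      rw [this, div_lt_iff₀ (by positivity)] at hk
      exact hk.le
    obtain ⟨N, hN⟩ := eventually_atTop.1 hev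
    obtain ⟨k₁, -, hk₁⟩ := Finset.exists_min_image (insert k₀ (Finset.range N)) g ⟨k₀, by simp⟩
    have hle : ∀ k : ℕ, g k₁ ^ (k + 1) ≤ |(p.1 * p.2 ^ k).trace| := by
      intro k
      by_cases hk : k < N
      · rw [← hgpow k]
        exact pow_le_pow_left₀ (hg0 _) (hk₁ k (by simp [hk])) _
      · exact (pow_le_pow_left₀ (hg0 _) (hk₁ k₀ (by simp)) _).trans (hN k (by omega))
    have heq : lsr p = g k₁ := by
      refine le_antisymm ?_ (le_lsr hp ((hk₁ k₀ (by simp)).trans hgr.le) hle)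
      refine le_of_pow_le_pow_left₀ (n := k₁ + 1) (by omega) (hg0 _) ?_
      rw [hgpow]
      exact lsr_pow_le hp k₁
    exact hasLFP_of_eq_trace hp (k := k₁) (by rw [heq, hgpow])

/-- The lower spectral radius is upper semicontinuous, being an infimum of continuous functions. -/
theorem isOpen_lsr_lt (ε : ℝ) : IsOpen {p : Mat 2 × Mat 2 | lsr p < ε} := by
  rw [isOpen_iff_mem_nhds]
  intro p hp
  have hp' : lsr p < ε := hp
  obtain ⟨n, hn, hlt⟩ := (((eventually_ge_atTop 1).and
    ((tendsto_minGrowth (insert_nonempty p.1 {p.2})).eventually (gt_mem_nhds hp')))).exists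
  have hne : ((fun w : List (Mat 2) => ‖w.prod‖ ^ (1 / (n : ℝ))) ''
      words {p.1, p.2} n).Nonempty :=
    ⟨_, List.replicate n p.2, ⟨by simp, by simp +contextual⟩, rfl⟩
  obtain ⟨_, ⟨w, hw, rfl⟩, hwlt⟩ := exists_lt_of_csInf_lt hne hlt
  -- the same word, read off in nearby pairs, is a continuous function of the pair
  have hread : ∀ w : List (Mat 2), (∀ X ∈ w, X ∈ ({p.1, p.2} : Set (Mat 2))) →
      ∃ W : Mat 2 × Mat 2 → List (Mat 2), W p = w ∧ (∀ q, (W q).length = w.length) ∧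
        (∀ q, ∀ X ∈ W q, X ∈ ({q.1, q.2} : Set (Mat 2))) ∧ Continuous fun q => (W q).prod := by
    intro w hw
    induction w with
    | nil => exact ⟨fun _ => [], by simp [continuous_const]⟩
    | cons X w ih =>
      obtain ⟨W, hW1, hW2, hW3, hW4⟩ := ih fun Y hY => hw Y (by simp [hY])
      obtain ⟨f, hf1, hf2, hf3⟩ : ∃ f : Mat 2 × Mat 2 → Mat 2, f p = X ∧
          (∀ q, f q ∈ ({q.1, q.2} : Set (Mat 2))) ∧ Continuous f := by
        rcases hw X (by simp) with h | h
        · exact ⟨Prod.fst, h.symm, by simp, continuous_fst⟩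
        · exact ⟨Prod.snd, h.symm, by simp, continuous_snd⟩
      refine ⟨fun q => f q :: W q, by simp [hf1, hW1], by simp [hW2], fun q Y hY => ?_, ?_⟩
      · rcases List.mem_cons.1 hY with rfl | hY
        · exact hf2 q
        · exact hW3 q Y hY
      · simpa only [List.prod_cons] using hf3.matrix_mul hW4
  obtain ⟨W, hW1, hW2, hW3, hW4⟩ := hread w hw.2
  have hcont : Continuous fun q => ‖(W q).prod‖ ^ (1 / (n : ℝ)) :=
    hW4.norm.rpow_const fun _ => Or.inr (by positivity)
  have hmem : {q | ‖(W q).prod‖ ^ (1 / (n : ℝ)) < ε} ∈ 𝓝 p :=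
    (isOpen_lt hcont continuous_const).mem_nhds (by simpa [hW1] using hwlt)
  exact mem_of_superset hmem fun q hq =>
    (lowerSpectralRadius_le_norm hn ⟨(hW2 q).trans hw.1, hW3 q⟩).trans_lt hq

end

/-! ### Small values of sine and cosine along arithmetic progressions -/

/-- The set where `|sin (s + l θ)|` is small, within an interval of length `L`, is covered by
neighbourhoods of at most `l L / π + 2` zeros. -/
theorem volume_abs_sin_lt_le (s a : ℝ) {l L b : ℝ} (hl : 0 < l) (hL : 0 ≤ L) (hb : 0 ≤ b) :
    volume {θ ∈ Icc a (a + L) | |Real.sin (s + l * θ)| < b} ≤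
      ENNReal.ofReal (b * (L + 2 * Real.pi / l)) := by
  have hπ := Real.pi_pos
  set m₀ : ℤ := ⌈(s + l * a) / Real.pi - 1 / 2⌉
  set m₁ : ℤ := ⌊(s + l * (a + L)) / Real.pi + 1 / 2⌋
  have hsub : {θ ∈ Icc a (a + L) | |Real.sin (s + l * θ)| < b} ⊆
      ⋃ m ∈ Finset.Icc m₀ m₁, Icc ((m * Real.pi - s - Real.pi * b / 2) / l)
        ((m * Real.pi - s + Real.pi * b / 2) / l) := by
    rintro θ ⟨⟨h1, h2⟩, h3⟩
    have hr := abs_le.1 (abs_sub_round ((s + l * θ) / Real.pi))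
    set m : ℤ := round ((s + l * θ) / Real.pi)
    have hy : |s + l * θ - m * Real.pi| ≤ Real.pi / 2 := by
      have : s + l * θ - m * Real.pi = ((s + l * θ) / Real.pi - m) * Real.pi := by
        field_simp
      rw [this, abs_mul, abs_of_pos hπ]
      have := abs_le.2 hr
      nlinarith
    have hsin : |Real.sin (s + l * θ)| = Real.sin |s + l * θ - m * Real.pi| := by
      rw [← Real.abs_sin_eq_sin_abs_of_abs_le_pi (hy.trans (by linarith)), Real.sin_sub_int_mul_pi,
        abs_mul, abs_zpow]
      simp
    have hjordan := Real.mul_le_sin (abs_nonneg _) hy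
    have hy' : |s + l * θ - m * Real.pi| ≤ Real.pi * b / 2 := by
      rw [← hsin] at hjordan
      have h4 := hjordan.trans h3.le
      rw [div_mul_eq_mul_div, div_le_iff₀ hπ] at h4
      linarith
    rw [abs_le] at hy'
    simp only [mem_iUnion]
    refine ⟨m, Finset.mem_Icc.2 ⟨Int.ceil_le.2 ?_, Int.le_floor.2 ?_⟩, ?_, ?_⟩
    · have : (s + l * a) / Real.pi ≤ (s + l * θ) / Real.pi := by gcongr
      linarith
    · have : (s + l * θ) / Real.pi ≤ (s + l * (a + L)) / Real.pi := by gcongr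
      linarith
    · rw [div_le_iff₀ hl]
      linarith
    · rw [le_div_iff₀ hl]
      linarith
  refine (measure_mono hsub).trans ((measure_biUnion_finset_le _ _).trans ?_)
  have hlen : ∀ m : ℤ, volume (Icc ((m * Real.pi - s - Real.pi * b / 2) / l)
        ((m * Real.pi - s + Real.pi * b / 2) / l)) = ENNReal.ofReal (Real.pi * b / l) := by
    intro m
    rw [Real.volume_Icc]
    congr 1
    field_simp
    ring
  simp only [hlen, Finset.sum_const, nsmul_eq_mul]
  rw [← ENNReal.ofReal_natCast, ← ENNReal.ofReal_mul (by positivity)]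
  refine ENNReal.ofReal_le_ofReal ?_
  have hcard : ((Finset.Icc m₀ m₁).card : ℝ) ≤ l * L / Real.pi + 2 := by
    have h0 : (s + l * a) / Real.pi - 1 / 2 ≤ m₀ := Int.le_ceil _
    have h1 : m₁ ≤ (s + l * (a + L)) / Real.pi + 1 / 2 := Int.floor_le _
    have h2 : (s + l * (a + L)) / Real.pi = (s + l * a) / Real.pi + l * L / Real.pi := by ring
    have h3 : 0 ≤ l * L / Real.pi := by positivity
    rw [Int.card_Icc]
    have : (((m₁ + 1 - m₀).toNat : ℤ) : ℝ) = max ((m₁ : ℝ) + 1 - m₀) 0 := by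
      rw [Int.toNat_eq_max]
      push_cast
      rfl
    rw [Int.cast_natCast] at this
    rw [this]
    exact max_le (by linarith) (by linarith)
  calc ((Finset.Icc m₀ m₁).card : ℝ) * (Real.pi * b / l)
      ≤ (l * L / Real.pi + 2) * (Real.pi * b / l) := by gcongr
    _ = _ := by field_simp

theorem summable_one_div_succ_sq : Summable fun k : ℕ => 1 / ((k : ℝ) + 1) ^ 2 := by
  have := (summable_nat_add_iff 1).2 (Real.summable_one_div_nat_pow.2 (by norm_num : 1 < 2))
  exact_mod_cast this

/-- Almost every phase `β` is badly approximable by the zeros of `cos (k θ + ·)`. -/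
theorem ae_exists_le_abs_cos (θ : ℝ) :
    ∀ᵐ β : ℝ, ∃ n : ℕ, ∀ k : ℕ,
      1 / ((n : ℝ) + 1) * (1 / ((k : ℝ) + 1) ^ 2) ≤ |Real.cos (k * θ + β)| := by
  set E : Set ℝ := {β | ¬ ∃ n : ℕ, ∀ k : ℕ,
      1 / ((n : ℝ) + 1) * (1 / ((k : ℝ) + 1) ^ 2) ≤ |Real.cos (k * θ + β)|} with hE
  have hM : ∀ M : ℕ, volume (E ∩ Icc (-(M : ℝ)) (-M + 2 * M)) = 0 := by
    intro M
    set S : ℝ := ∑' k : ℕ, 1 / ((k : ℝ) + 1) ^ 2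
    set D : ℝ := 2 * M + 2 * Real.pi / 1
    have hD : 0 ≤ D := by positivity
    have hbound : ∀ n : ℕ, volume (E ∩ Icc (-(M : ℝ)) (-M + 2 * M)) ≤
        ENNReal.ofReal (1 / ((n : ℝ) + 1) * (S * D)) := by
      intro n
      have hsub : E ∩ Icc (-(M : ℝ)) (-M + 2 * M) ⊆ ⋃ k : ℕ,
          {β ∈ Icc (-(M : ℝ)) (-M + 2 * M) | |Real.sin ((k * θ + Real.pi / 2) + 1 * β)| <
            1 / ((n : ℝ) + 1) * (1 / ((k : ℝ) + 1) ^ 2)} := by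
        rintro β ⟨h1, h2⟩
        simp only [hE, mem_ofPred_eq, not_exists, not_forall, not_le] at h1
        obtain ⟨k, hk⟩ := h1 n
        refine mem_iUnion.2 ⟨k, h2, ?_⟩
        have : k * θ + Real.pi / 2 + 1 * β = (k * θ + β) + Real.pi / 2 := by ring
        rwa [this, Real.sin_add_pi_div_two]
      refine (measure_mono hsub).trans ((measure_iUnion_le _).trans ?_)
      refine (ENNReal.tsum_le_tsum fun k => volume_abs_sin_lt_le _ _ one_pos (by positivity)
        (by positivity)).trans ?_
      rw [← ENNReal.ofReal_tsum_of_nonneg (fun k => by positivity)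
        ((summable_one_div_succ_sq.mul_left _).mul_right _)]
      rw [tsum_mul_right, tsum_mul_left, mul_assoc]
    have hlim : Tendsto (fun n : ℕ => ENNReal.ofReal (1 / ((n : ℝ) + 1) * (S * D))) atTop (𝓝 0) := by
      have := (tendsto_one_div_add_atTop_nhds_zero_nat (𝕜 := ℝ)).mul_const (S * D)
      rw [zero_mul] at this
      simpa using ENNReal.tendsto_ofReal this
    exact le_antisymm (ge_of_tendsto' hlim hbound) bot_le
  rw [ae_iff]
  refine measure_mono_null (fun β hβ => ?_) (measure_iUnion_null hM)
  obtain ⟨M, hM'⟩ := exists_nat_ge |β|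
  rw [abs_le] at hM'
  exact mem_iUnion.2 ⟨M, hβ, hM'.1, by linarith [hM'.2]⟩

/-! ### Phases whose infimum is not attained -/

/-- The parameters `(θ, α)` at which all the numbers `K |cos (k θ + α)|` exceed `l ^ (k + 1)` by a
uniform exponential margin. -/
def marginSet (K l : ℝ) : Set (ℝ × ℝ) :=
  {x | ∃ l' : ℝ, l < l' ∧ ∀ k : ℕ, l' ^ (k + 1) ≤ K * |Real.cos (k * x.1 + x.2)|}

theorem le_one_of_forall_pow_le {l K : ℝ} (h : ∀ k : ℕ, l ^ (k + 1) ≤ K) : l ≤ 1 := by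
  by_contra! hl
  obtain ⟨n, hn⟩ := pow_unbounded_of_one_lt K hl
  have := h n
  have h2 : l ^ n ≤ l ^ (n + 1) := pow_le_pow_right₀ hl.le (by omega)
  linarith

theorem abs_cos_sub_cos_le (x y : ℝ) : |Real.cos x - Real.cos y| ≤ |x - y| :=
  by simpa [Real.dist_eq] using Real.lipschitzWith_cos.dist_le_mul x y

/-- With `N` of size `μ ^ (-j)`, for `ν < μ < l`, perturbations of size `1 / N` are harmless for the
first `j` conditions, while the total measure of the parameters violating one of the conditions of
index at least `j` is less than `1 / N ^ 2`. -/
theorem exists_scale {K l μ ν ε : ℝ} (hK : 0 < K) (hν : 0 < ν) (hνμ : ν < μ) (hμl : μ < l)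
    (hl : l ≤ 1) (hε : 0 < ε) :
    ∃ j N : ℕ, 1 ≤ N ∧ 1 / (N : ℝ) < ε ∧ ν ^ (N + 1) / K ≤ 1 / (N : ℝ) / 2 ∧
      ν ^ (N + 1) / K ≤ 1 ∧
      (∀ k < j, K * ((k + 1) * (10 / (N : ℝ))) ≤ l ^ (k + 1) - ν ^ (k + 1)) ∧
      8 / K * (∑' k : ℕ, ((k + j : ℕ) + 1 : ℝ) * ν ^ (k + j + 1)) < 1 / (N : ℝ) := by
  have hμ : 0 < μ := hν.trans hνμ
  have hl0 : 0 < l := hμ.trans hμl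
  have hμ1 : μ < 1 := hμl.trans_le hl
  have hν1 : ν < 1 := hνμ.trans hμ1
  have hq0 : 0 ≤ ν / μ := by positivity
  have hq1 : ν / μ < 1 := (div_lt_one hμ).2 hνμ
  set f : ℕ → ℝ := fun i => ((i : ℝ) + 1) * (ν / μ) ^ i with hf
  have hfs : Summable f := by
    have h1 : Summable fun k : ℕ => ((k : ℝ) ^ 1 * (ν / μ) ^ k) :=
      summable_pow_mul_geometric_of_norm_lt_one 1 (by rwa [Real.norm_eq_abs, abs_of_nonneg hq0])
    refine (h1.add (summable_geometric_of_lt_one hq0 hq1)).congr fun k => ?_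
    rw [hf]
    ring
  have hNtop : Tendsto (fun j : ℕ => ⌈(μ ^ j)⁻¹⌉₊) atTop atTop := by
    refine tendsto_nat_ceil_atTop.comp ?_
    simp_rw [← inv_pow]
    exact tendsto_pow_atTop_atTop_of_one_lt ((one_lt_inv₀ hμ).2 hμ1)
  have h3 := (tendsto_pow_atTop_nhds_zero_of_lt_one hμ.le hμ1).eventually (gt_mem_nhds hε)
  have h4 := hNtop.eventually ((tendsto_pow_const_mul_const_pow_of_lt_one 1 hν.le hν1).eventually
    (gt_mem_nhds (half_pos hK)))
  have h5 := hNtop.eventually ((tendsto_pow_atTop_nhds_zero_of_lt_one hν.le hν1).eventually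
    (gt_mem_nhds hK))
  have h6 := (tendsto_pow_const_mul_const_pow_of_lt_one 1 (div_pos hμ hl0).le
    ((div_lt_one hl0).2 hμl)).eventually
      (gt_mem_nhds (div_pos (sub_pos.2 (hνμ.trans hμl)) (by positivity : 0 < 10 * K)))
  have h7 := (tendsto_sum_nat_add f).eventually (gt_mem_nhds (by positivity : 0 < K / 16))
  obtain ⟨j, h3, h4, h5, h6, h7⟩ := (h3.and (h4.and (h5.and (h6.and h7)))).exists
  have hμj : 0 < μ ^ j := pow_pos hμ j
  set N : ℕ := ⌈(μ ^ j)⁻¹⌉₊ with hN_def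
  have hN : 1 ≤ N := Nat.one_le_iff_ne_zero.2 (Nat.ceil_pos.2 (inv_pos.2 hμj)).ne'
  have hN0 : (0 : ℝ) < N := by exact_mod_cast hN
  have hNle : 1 / (N : ℝ) ≤ μ ^ j := by
    rw [one_div]
    exact inv_le_of_inv_le₀ hμj (Nat.le_ceil _)
  have hNge : (N : ℝ) * μ ^ j ≤ 2 := by
    have h8 : (N : ℝ) < (μ ^ j)⁻¹ + 1 := Nat.ceil_lt_add_one (inv_pos.2 hμj).le
    have h9 : μ ^ j ≤ 1 := pow_le_one₀ hμ.le hμ1.le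
    have h10 : ((μ ^ j)⁻¹ + 1) * μ ^ j = 1 + μ ^ j := by
      field_simp
    nlinarith
  have hνN : ν ^ (N + 1) ≤ ν ^ N := pow_le_pow_of_le_one hν.le hν1.le (by omega)
  refine ⟨j, N, hN, hNle.trans_lt h3, ?_, ?_, fun k hk => ?_, ?_⟩
  · rw [div_le_iff₀ hK, div_div, div_mul_eq_mul_div, one_mul, le_div_iff₀ (by positivity)]
    rw [pow_one] at h4
    nlinarith
  · rw [div_le_one hK]
    exact hνN.trans h5.le
  · have h8 : l ^ j * (l - ν) ≤ l ^ (k + 1) - ν ^ (k + 1) := by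
      have h9 : l ^ j ≤ l ^ k := pow_le_pow_of_le_one hl0.le hl hk.le
      have h10 : ν ^ k ≤ l ^ k := pow_le_pow_left₀ hν.le (hνμ.trans hμl).le k
      rw [pow_succ, pow_succ]
      have : 0 < l - ν := sub_pos.2 (hνμ.trans hμl)
      nlinarith
    refine le_trans ?_ h8
    rw [pow_one, div_pow, lt_div_iff₀ (by positivity)] at h6
    have h9 : (j : ℝ) * (μ ^ j / l ^ j) * (10 * K) * l ^ j = 10 * K * (j * μ ^ j) := by
      field_simp
    have h10 : 10 * K * (j * μ ^ j) ≤ (l - ν) * l ^ j := by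
      rw [← h9]
      gcongr
    have h11 : (k : ℝ) + 1 ≤ j := by exact_mod_cast hk
    calc K * ((k + 1) * (10 / (N : ℝ))) = 10 * K * (((k : ℝ) + 1) * (1 / N)) := by ring
      _ ≤ 10 * K * (j * μ ^ j) := by gcongr
      _ ≤ _ := by linarith
  · have h8 : ∑' k : ℕ, ((k + j : ℕ) + 1 : ℝ) * ν ^ (k + j + 1) ≤ μ ^ j * ∑' k : ℕ, f (k + j) := by
      rw [← tsum_mul_left]
      have hterm : ∀ k : ℕ, ((k + j : ℕ) + 1 : ℝ) * ν ^ (k + j + 1) ≤ μ ^ j * f (k + j) := by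
        intro k
        have h9 : ν ^ (k + j + 1) ≤ μ ^ j * (ν / μ) ^ (k + j) := by
          calc ν ^ (k + j + 1) ≤ ν ^ (k + j) := pow_le_pow_of_le_one hν.le hν1.le (by omega)
            _ = μ ^ (k + j) * (ν / μ) ^ (k + j) := by
                rw [← mul_pow, mul_div_cancel₀ _ hμ.ne']
            _ ≤ μ ^ j * (ν / μ) ^ (k + j) := by
                gcongr ?_ * _
                exact pow_le_pow_of_le_one hμ.le hμ1.le (by omega)
        calc ((k + j : ℕ) + 1 : ℝ) * ν ^ (k + j + 1)
            ≤ ((k + j : ℕ) + 1 : ℝ) * (μ ^ j * (ν / μ) ^ (k + j)) := by gcongr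
          _ = _ := by rw [hf]; ring
      have hr := ((summable_nat_add_iff j).2 hfs).mul_left (μ ^ j)
      exact Summable.tsum_le_tsum hterm
        (Summable.of_nonneg_of_le (fun k => by positivity) hterm hr) hr
    rw [lt_div_iff₀ hN0]
    have h9 : 0 ≤ ∑' k : ℕ, f (k + j) := tsum_nonneg fun k => by positivity
    calc 8 / K * (∑' k : ℕ, ((k + j : ℕ) + 1 : ℝ) * ν ^ (k + j + 1)) * N
        ≤ 8 / K * (μ ^ j * ∑' k : ℕ, f (k + j)) * N := by gcongr
      _ = 8 / K * (N * μ ^ j) * ∑' k : ℕ, f (k + j) := by ring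
      _ ≤ 8 / K * 2 * ∑' k : ℕ, f (k + j) := by gcongr
      _ < 8 / K * 2 * (K / 16) := by gcongr
      _ = 1 := by field_simp; norm_num

/-- On a short interval, the conditions of index at least `j` other than `N` hold simultaneously at
some point, since the measures of their exceptional sets add up to less than its length. -/
theorem exists_mem_Icc_forall_le {K ν s a : ℝ} (hK : 0 < K) (hν : 0 < ν) (hν1 : ν < 1)
    {j N : ℕ} (hN : 1 ≤ N)
    (h : 8 / K * (∑' k : ℕ, ((k + j : ℕ) + 1 : ℝ) * ν ^ (k + j + 1)) < 1 / (N : ℝ)) :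
    ∃ θ ∈ Icc a (a + 1 / (N : ℝ) ^ 2), ∀ k : ℕ, j ≤ k → k ≠ N →
      ν ^ (k + 1) ≤ K * |Real.sin (s + ((k : ℝ) - N) * θ)| := by
  have hN0 : (0 : ℝ) < N := by exact_mod_cast hN
  have hsum : Summable fun k : ℕ => ((k + j : ℕ) + 1 : ℝ) * ν ^ (k + j + 1) := by
    have h1 : Summable fun k : ℕ => ((k : ℝ) ^ 1 * ν ^ k) :=
      summable_pow_mul_geometric_of_norm_lt_one 1 (by rwa [Real.norm_eq_abs, abs_of_pos hν])
    have h2 := (summable_nat_add_iff (j + 1)).2 h1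
    refine h2.congr fun k => ?_
    push_cast
    ring
  have hone : ∀ k : ℕ, j ≤ k → k ≠ N →
      volume {θ ∈ Icc a (a + 1 / (N : ℝ) ^ 2) |
        |Real.sin (s + ((k : ℝ) - N) * θ)| < ν ^ (k + 1) / K} ≤
      ENNReal.ofReal (8 / K * (((k : ℝ) + 1) * ν ^ (k + 1)) * (1 / N)) := by
    intro k hjk hkN
    have hl : 0 < |(k : ℝ) - N| := by
      rw [abs_pos, sub_ne_zero]
      exact_mod_cast hkN
    -- a frequency `|k - N|` which is small compared with `N` forces `k` to be comparable to `N`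
    have hfreq : (N : ℝ) ≤ (k + 1) * |(k : ℝ) - N| := by
      have : (N : ℤ) ≤ (k + 1) * |(k : ℤ) - N| := by
        rcases lt_or_gt_of_ne hkN with h | h
        · rw [abs_of_neg (by omega)]
          nlinarith
        · rw [abs_of_pos (by omega)]
          nlinarith
      exact_mod_cast this
    have hset : ∃ s' : ℝ, ∀ θ : ℝ, |Real.sin (s + ((k : ℝ) - N) * θ)| =
        |Real.sin (s' + |(k : ℝ) - N| * θ)| := by
      rcases abs_choice ((k : ℝ) - N) with h | h
      · exact ⟨s, fun θ => by rw [h]⟩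
      · refine ⟨-s, fun θ => ?_⟩
        rw [h, ← abs_neg, ← Real.sin_neg]
        congr 2
        ring
    obtain ⟨s', hs'⟩ := hset
    simp only [hs']
    refine (volume_abs_sin_lt_le s' a hl (by positivity) (by positivity)).trans
      (ENNReal.ofReal_le_ofReal ?_)
    have h1 : 1 / (N : ℝ) ^ 2 ≤ (k + 1) * (1 / N) := by
      rw [pow_two, one_div, mul_inv, ← one_div]
      have h2 : 1 / (N : ℝ) ≤ 1 := by
        rw [div_le_one hN0]
        exact_mod_cast hN
      gcongr
      linarith [(Nat.cast_nonneg k : (0 : ℝ) ≤ k)]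
    have h2 : 2 * Real.pi / |(k : ℝ) - N| ≤ 7 * ((k + 1) * (1 / N)) := by
      rw [div_le_iff₀ hl]
      have h3 : 1 ≤ (k + 1) * |(k : ℝ) - N| * (1 / N) := by
        rw [mul_one_div, le_div_iff₀ hN0, one_mul]
        exact hfreq
      have h4 := Real.pi_lt_d2
      nlinarith
    calc ν ^ (k + 1) / K * (1 / (N : ℝ) ^ 2 + 2 * Real.pi / |(k : ℝ) - N|)
        ≤ ν ^ (k + 1) / K * ((k + 1) * (1 / N) + 7 * ((k + 1) * (1 / N))) := by gcongr
      _ = _ := by ring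
  by_contra! hcon
  have hsub : Icc a (a + 1 / (N : ℝ) ^ 2) ⊆ ⋃ i : ℕ, {θ ∈ Icc a (a + 1 / (N : ℝ) ^ 2) |
        i + j ≠ N ∧ |Real.sin (s + (((i + j : ℕ) : ℝ) - N) * θ)| < ν ^ (i + j + 1) / K} := by
    intro θ hθ
    obtain ⟨k, hjk, hkN, hk⟩ := hcon θ hθ
    refine mem_iUnion.2 ⟨k - j, hθ, ?_⟩
    rw [Nat.sub_add_cancel hjk]
    exact ⟨hkN, by rwa [lt_div_iff₀' hK]⟩
  have hle : volume (Icc a (a + 1 / (N : ℝ) ^ 2)) ≤ ENNReal.ofReal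
      (8 / K * (∑' k : ℕ, ((k + j : ℕ) + 1 : ℝ) * ν ^ (k + j + 1)) * (1 / N)) := by
    refine (measure_mono hsub).trans ((measure_iUnion_le _).trans ?_)
    rw [← tsum_mul_left, ← tsum_mul_right, ENNReal.ofReal_tsum_of_nonneg (fun k => by positivity)
      ((hsum.mul_left _).mul_right _)]
    refine ENNReal.tsum_le_tsum fun i => ?_
    by_cases hi : i + j = N
    · simp [hi]
    · simpa [hi] using hone (i + j) (by omega) hi
  rw [Real.volume_Icc, ENNReal.ofReal_le_ofReal_iff (by positivity)] at hle
  have : 1 / (N : ℝ) ^ 2 = 1 / N * (1 / N) := by ring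
  have hpos : 0 < 1 / (N : ℝ) := by positivity
  nlinarith

/-- Resonances can be created: near every point of the margin set there is another one, at which
some root of `K |cos (k θ + α)|` is as close to `l` as desired. -/
theorem exists_marginSet_near {K l : ℝ} (hK : 0 < K) (hl : 0 < l) {x : ℝ × ℝ}
    (hx : x ∈ marginSet K l) {ε : ℝ} (hε : 0 < ε) :
    ∃ y ∈ marginSet K l, dist y x < ε ∧
      ∃ k : ℕ, K * |Real.cos (k * y.1 + y.2)| < (l + ε) ^ (k + 1) := by
  obtain ⟨l', hll', hx⟩ := hx
  have hl'1 : l' ≤ 1 := le_one_of_forall_pow_le (K := K) fun k => (hx k).trans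
    (mul_le_of_le_one_right hK.le (Real.abs_cos_le_one _))
  obtain ⟨ν, hlν, hν⟩ := exists_between (lt_min hll' (by linarith : l < l + ε))
  obtain ⟨hνl', hνε⟩ := lt_min_iff.1 hν
  obtain ⟨μ, hνμ, hμl'⟩ := exists_between hνl'
  have hν0 : 0 < ν := hl.trans hlν
  obtain ⟨j, N, hN, hNε, hs, hs1, hsmall, htail⟩ :=
    exists_scale hK hν0 hνμ hμl' hl'1 (by positivity : 0 < ε / 10)
  have hN0 : (0 : ℝ) < N := by exact_mod_cast hN
  have hπ := Real.pi_pos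
  have hπ' := Real.pi_lt_d2
  -- the phase offset `s` at which the condition of index `N` is an equality
  set s : ℝ := Real.arcsin (ν ^ (N + 1) / K) with hs_def
  have hsin : Real.sin s = ν ^ (N + 1) / K :=
    Real.sin_arcsin (by have : 0 ≤ ν ^ (N + 1) / K := by positivity
                        linarith) hs1
  have hs0 : 0 ≤ s := Real.arcsin_nonneg.2 (by positivity)
  have hs2 : s ≤ 1 / N := by
    have h1 := Real.mul_le_sin hs0 (Real.arcsin_le_pi_div_two _)
    rw [hsin] at h1
    have h2 : 2 / Real.pi * s ≤ 1 / N / 2 := h1.trans hs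
    rw [div_mul_eq_mul_div, div_le_iff₀ hπ] at h2
    have : 0 < 1 / (N : ℝ) := by positivity
    nlinarith
  set m : ℤ := round ((N * x.1 + x.2) / Real.pi - 1 / 2) with hm
  have hround := abs_le.1 (abs_sub_round ((N * x.1 + x.2) / Real.pi - 1 / 2))
  rw [← hm] at hround
  set a : ℝ := (Real.pi / 2 + m * Real.pi - x.2) / N with ha
  have hNa : N * a = Real.pi / 2 + m * Real.pi - x.2 := by
    rw [ha]
    field_simp
  have hdist : |a - x.1| ≤ 2 / N := by
    have h1 : a - x.1 = -(((N * x.1 + x.2) / Real.pi - 1 / 2 - m) * Real.pi) / N := by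
      rw [eq_div_iff hN0.ne', sub_mul, mul_comm a, hNa]
      field_simp
      ring
    rw [h1, abs_div, abs_neg, abs_mul, abs_of_pos hπ, abs_of_pos hN0]
    gcongr
    have := abs_le.2 hround
    nlinarith
  obtain ⟨θ, ⟨hθ1, hθ2⟩, hθ⟩ := exists_mem_Icc_forall_le (s := s) (a := a) hK hν0
    (hνl'.trans_le hl'1) hN htail
  set α : ℝ := Real.pi / 2 + m * Real.pi + s - N * θ with hα
  have hcos : ∀ k : ℕ, |Real.cos (k * θ + α)| = |Real.sin (s + ((k : ℝ) - N) * θ)| := by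
    intro k
    have : k * θ + α = (s + ((k : ℝ) - N) * θ) + Real.pi / 2 + m * Real.pi := by
      rw [hα]
      ring
    rw [this, Real.cos_add_int_mul_pi, abs_mul, abs_zpow, Real.cos_add_pi_div_two]
    simp
  have hNsq : 1 / (N : ℝ) ^ 2 ≤ 1 / N := by
    have : (1 : ℝ) ≤ N := by exact_mod_cast hN
    gcongr
    nlinarith
  have hNpos : 0 < 1 / (N : ℝ) := by positivity
  have hθx : |θ - x.1| ≤ 3 * (1 / N) := by
    rw [abs_le] at hdist ⊢
    have : 2 / (N : ℝ) = 2 * (1 / N) := by ring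
    constructor <;> linarith [hdist.1, hdist.2]
  have hαx : |α - x.2| ≤ 1 / N := by
    have h1 : α - x.2 = s - N * (θ - a) := by
      rw [hα]
      linear_combination -hNa
    have h2 : N * (θ - a) ≤ 1 / N := by
      have : N * (1 / (N : ℝ) ^ 2) = 1 / N := by field_simp
      rw [← this]
      gcongr
      linarith
    have h3 : 0 ≤ N * (θ - a) := mul_nonneg hN0.le (by linarith)
    rw [h1, abs_le]
    constructor <;> linarith
  refine ⟨(θ, α), ⟨ν, hlν, fun k => ?_⟩, ?_, N, ?_⟩
  · by_cases hkj : k < j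
    · have h1 := abs_cos_sub_cos_le (k * x.1 + x.2) (k * θ + α)
      have h2 : |k * x.1 + x.2 - (k * θ + α)| ≤ (k + 1) * (10 / N) := by
        have : k * x.1 + x.2 - (k * θ + α) = -(k * (θ - x.1) + (α - x.2)) := by ring
        rw [this, abs_neg]
        refine (abs_add_le _ _).trans ?_
        rw [abs_mul, Nat.abs_cast]
        have h3 : (k : ℝ) * |θ - x.1| ≤ k * (3 * (1 / N)) := by gcongr
        have h4 : (0 : ℝ) ≤ k * (1 / N) := by positivity
        have h5 : ((k : ℝ) + 1) * (10 / N) = 10 * (k * (1 / N)) + 10 * (1 / N) := by ring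
        linarith
      have h3 : |Real.cos (k * x.1 + x.2)| - |Real.cos (k * θ + α)| ≤ (k + 1) * (10 / N) :=
        (abs_sub_abs_le_abs_sub _ _).trans (h1.trans h2)
      have h4 := hsmall k hkj
      have h5 := hx k
      have h6 := mul_le_mul_of_nonneg_left h3 hK.le
      rw [mul_sub] at h6
      dsimp only
      linarith
    · by_cases hkN : k = N
      · subst hkN
        dsimp only
        rw [hcos, sub_self, zero_mul, add_zero, hsin, abs_of_pos (by positivity)]
        exact (mul_div_cancel₀ _ hK.ne').ge
      · dsimp only
        rw [hcos]
        exact hθ k (by omega) hkN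
  · rw [Prod.dist_eq, max_lt_iff, Real.dist_eq, Real.dist_eq]
    constructor
    · dsimp only
      linarith
    · dsimp only
      linarith
  · dsimp only
    rw [hcos, sub_self, zero_mul, add_zero, hsin, abs_of_pos (by positivity),
      mul_div_cancel₀ _ hK.ne']
    exact pow_lt_pow_left₀ hνε hν0.le (by omega)

/-- Near every point of the margin set there are parameters for which `l` is the infimum of the
roots `(K |cos (k θ + α)|) ^ (1 / (k + 1))`, and is not attained. -/
theorem exists_not_attained {K l : ℝ} (hK : 0 < K) (hl : 0 < l) {x : ℝ × ℝ}
    (hx : x ∈ marginSet K l) {V : Set (ℝ × ℝ)} (hV : V ∈ 𝓝 x) :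
    ∃ y ∈ V, (∀ k : ℕ, l ^ (k + 1) < K * |Real.cos (k * y.1 + y.2)|) ∧
      ∀ μ : ℝ, l < μ → ∃ k : ℕ, K * |Real.cos (k * y.1 + y.2)| < μ ^ (k + 1) := by
  set X : Set (ℝ × ℝ) := closure (marginSet K l) with hX
  have hXc : IsClosed X := isClosed_closure
  have : CompleteSpace X := hXc.completeSpace_coe
  have hS : ∀ {O : Set X}, (∀ y : X, (y : ℝ × ℝ) ∈ marginSet K l → y ∈ closure O) → Dense O := by
    intro O hO
    rw [dense_iff_closure_eq, ← closure_closure, ← dense_iff_closure_eq]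
    refine Dense.mono (s₁ := Subtype.val ⁻¹' marginSet K l) (fun y hy => hO y hy) ?_
    rw [Subtype.dense_iff]
    intro y hy
    rw [Subtype.image_preimage_coe, inter_eq_right.2 subset_closure]
    exact hy
  have hcont : ∀ k : ℕ, Continuous fun y : X =>
      K * |Real.cos (k * (y : ℝ × ℝ).1 + (y : ℝ × ℝ).2)| := by
    intro k
    fun_prop
  set P : ℕ → Set X := fun k =>
    {y | l ^ (k + 1) < K * |Real.cos (k * (y : ℝ × ℝ).1 + (y : ℝ × ℝ).2)|}
  set Q : ℕ → Set X := fun n => ⋃ k : ℕ,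
    {y | K * |Real.cos (k * (y : ℝ × ℝ).1 + (y : ℝ × ℝ).2)| < (l + 1 / ((n : ℝ) + 1)) ^ (k + 1)}
  have hPo : ∀ k, IsOpen (P k) := fun k => isOpen_lt continuous_const (hcont k)
  have hQo : ∀ n, IsOpen (Q n) := fun n => isOpen_iUnion fun k =>
    isOpen_lt (hcont k) continuous_const
  have hPd : ∀ k, Dense (P k) := fun k => hS fun y hy => subset_closure <| by
    obtain ⟨l', hl', h⟩ := hy
    exact (pow_lt_pow_left₀ hl' hl.le (by omega)).trans_le (h k)
  have hQd : ∀ n, Dense (Q n) := fun n => hS fun y hy => by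
    rw [Metric.mem_closure_iff]
    intro ε hε
    have hn : 0 < 1 / ((n : ℝ) + 1) := by positivity
    obtain ⟨z, hz, hzy, k, hk⟩ := exists_marginSet_near hK hl hy (lt_min hε hn)
    refine ⟨⟨z, subset_closure hz⟩, mem_iUnion.2 ⟨k, ?_⟩, ?_⟩
    · refine lt_of_lt_of_le hk (pow_le_pow_left₀ ?_ ?_ _)
      · have := lt_min hε hn
        linarith
      · have := min_le_right ε (1 / ((n : ℝ) + 1))
        linarith
    · rw [dist_comm]
      exact hzy.trans_le (min_le_left _ _)
  have hdense : Dense ((⋂ k, P k) ∩ ⋂ n, Q n) :=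
    (dense_iInter_of_isOpen hPo hPd).inter_of_Gδ
      (IsGδ.iInter_of_isOpen hPo) (IsGδ.iInter_of_isOpen hQo) (dense_iInter_of_isOpen hQo hQd)
  obtain ⟨W, hWV, hWo, hxW⟩ := mem_nhds_iff.1 hV
  obtain ⟨y, hyW, hyP, hyQ⟩ := hdense.inter_open_nonempty (Subtype.val ⁻¹' W)
    (hWo.preimage continuous_subtype_val) ⟨⟨x, subset_closure hx⟩, hxW⟩
  refine ⟨y, hWV hyW, fun k => mem_iInter.1 hyP k, fun μ hμ => ?_⟩
  obtain ⟨n, hn⟩ := exists_nat_one_div_lt (sub_pos.2 hμ)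
  obtain ⟨k, hk⟩ := mem_iUnion.1 (mem_iInter.1 hyQ n)
  refine ⟨k, lt_of_lt_of_le hk (pow_le_pow_left₀ (by positivity) (by linarith) _)⟩

/-! ### Continuity, density and category -/

/-- Through every point of `setPE` passes a two-parameter family of pairs (rotate the rank-one
matrix, and change the argument of the eigenvalues of the elliptic one) along which the traces are
given by a cosine of amplitude `C`. -/
theorem exists_phase_family {p : Mat 2 × Mat 2} (hp : p ∈ setPE) :
    ∃ (r C : ℝ) (x : ℝ × ℝ) (Φ : ℝ × ℝ → Mat 2 × Mat 2), 0 < r ∧ 0 < C ∧ Continuous Φ ∧ Φ x = p ∧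
      (∀ y, ∀ k : ℕ, ((Φ y).1 * (Φ y).2 ^ k).trace = r ^ k * (C * Real.cos (k * y.1 + y.2))) ∧
      (∀ y, √(Φ y).2.det = r) ∧ ∀ᶠ y in 𝓝 x, Φ y ∈ setPE := by
  obtain ⟨A, B⟩ := p
  obtain ⟨hA, hB⟩ := hp
  obtain ⟨J, r, t, hJ, -, hr, rfl⟩ := exists_eq_smul_rot hB
  obtain ⟨hd, ht⟩ := mem_setP_iff.1 hA
  dsimp only at hA hB hd ht
  obtain ⟨C, α, hC, hc, hs⟩ := exists_polar A.trace (-(J * A).trace)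
  have hCpos : 0 < C := by
    refine lt_of_le_of_ne hC ?_
    rintro rfl
    exact ht (by simpa using hc)
  have hcosα : Real.cos α ≠ 0 := by
    intro h
    rw [h, mul_zero] at hc
    exact ht hc
  have htr : ∀ u : ℝ, (rot J u * A).trace = C * Real.cos (u + α) := by
    intro u
    rw [Real.cos_add, rot, add_mul, smul_mul_assoc, smul_mul_assoc, Matrix.trace_add,
      Matrix.trace_smul, Matrix.trace_smul, one_mul, smul_eq_mul, smul_eq_mul]
    linear_combination Real.cos u * hc - Real.sin u * hs
  refine ⟨r, C, (t, α), fun y => (rot J (y.2 - α) * A, r • rot J y.1), hr, hCpos, ?_, ?_, ?_, ?_, ?_⟩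
  · have := continuous_rot J
    exact ((this.comp (continuous_snd.sub continuous_const)).matrix_mul continuous_const).prodMk
      ((this.comp continuous_fst).const_smul r)
  · simp [rot_zero]
  · intro y k
    dsimp only
    rw [smul_rot_pow hJ, mul_smul_comm, Matrix.trace_smul, Matrix.trace_mul_comm, ← mul_assoc,
      rot_mul_rot hJ, htr, smul_eq_mul]
    have : k * y.1 + (y.2 - α) + α = k * y.1 + y.2 := by ring
    rw [this]
  · intro y
    exact sqrt_det_smul_rot hJ hr _
  · have h1 : ∀ᶠ y : ℝ × ℝ in 𝓝 (t, α), r * Real.sin y.1 ≠ 0 :=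
      ((Real.continuous_sin.comp continuous_fst).const_mul r).continuousAt.eventually_ne
        ((smul_rot_mem_setE_iff hJ r t).1 hB)
    have h2 : ∀ᶠ y : ℝ × ℝ in 𝓝 (t, α), Real.cos y.2 ≠ 0 :=
      (Real.continuous_cos.comp continuous_snd).continuousAt.eventually_ne hcosα
    filter_upwards [h1, h2] with y hy1 hy2
    refine ⟨mem_setP_iff.2 ⟨by simp [hd], ?_⟩, (smul_rot_mem_setE_iff hJ r _).2 hy1⟩
    dsimp only
    rw [htr, sub_add_cancel]
    exact mul_ne_zero hCpos.ne' hy2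

theorem lsr_eq_zero_of_trace {p : Mat 2 × Mat 2} (hp : p ∈ setPE) {k : ℕ}
    (h : (p.1 * p.2 ^ k).trace = 0) : lsr p = 0 := by
  have := lsr_pow_le hp k
  rw [h, abs_zero] at this
  exact (pow_eq_zero_iff (by omega)).1 (le_antisymm this (pow_nonneg (lsr_nonneg p) _))

theorem exists_near_lsr_eq_zero {p : Mat 2 × Mat 2} (hp : p ∈ setPE) {W : Set (Mat 2 × Mat 2)}
    (hW : W ∈ 𝓝 p) : ∃ q ∈ W, q ∈ setPE ∧ lsr q = 0 ∧ HasLFP q := by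
  obtain ⟨r, C, x, Φ, hr, hC, hΦ, rfl, htr, hdet, hPE⟩ := exists_phase_family hp
  have hV := (hΦ.continuousAt.preimage_mem_nhds hW : Φ ⁻¹' W ∈ 𝓝 x)
  have hcurve : Tendsto (fun θ : ℝ => (θ, x.2)) (𝓝 x.1) (𝓝 x) :=
    (continuous_id.prodMk continuous_const).tendsto' _ _ rfl
  obtain ⟨δ, hδ, hball⟩ := Metric.mem_nhds_iff.1 (hcurve (inter_mem hV hPE))
  obtain ⟨k, hk⟩ := exists_nat_gt (Real.pi / δ)
  have hπ := Real.pi_pos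
  have hk0 : (0 : ℝ) < k := (by positivity : 0 < Real.pi / δ).trans hk
  -- move `θ` to the closest value for which the cosine of index `k` vanishes
  set m : ℤ := round ((k * x.1 + x.2) / Real.pi - 1 / 2) with hm
  have hround := abs_sub_round ((k * x.1 + x.2) / Real.pi - 1 / 2)
  rw [← hm] at hround
  set θ : ℝ := (Real.pi / 2 + m * Real.pi - x.2) / k with hθ
  have hkθ : k * θ + x.2 = Real.pi / 2 + m * Real.pi := by
    rw [hθ]
    field_simp
    ring
  have hdist : θ ∈ Metric.ball x.1 δ := by
    rw [Metric.mem_ball, Real.dist_eq]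
    have h1 : θ - x.1 = -(((k * x.1 + x.2) / Real.pi - 1 / 2 - m) * Real.pi) / k := by
      rw [hθ]
      field_simp
      ring
    rw [h1, abs_div, abs_neg, abs_mul, abs_of_pos hπ, abs_of_pos hk0, div_lt_iff₀ hk0]
    rw [div_lt_iff₀ hδ] at hk
    nlinarith
  obtain ⟨hθW, hθPE⟩ := hball hdist
  have hzero : ((Φ (θ, x.2)).1 * (Φ (θ, x.2)).2 ^ k).trace = 0 := by
    rw [htr]
    dsimp only
    rw [hkθ, Real.cos_add_int_mul_pi, Real.cos_pi_div_two]
    simp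
  have hlsr := lsr_eq_zero_of_trace hθPE hzero
  refine ⟨_, hθW, hθPE, hlsr, hasLFP_of_eq_trace hθPE (k := k) ?_⟩
  rw [hzero, hlsr]
  simp

theorem exists_near_lsr_pos {p : Mat 2 × Mat 2} (hp : p ∈ setPE) {W : Set (Mat 2 × Mat 2)}
    (hW : W ∈ 𝓝 p) : ∃ q ∈ W, q ∈ setPE ∧ 0 < lsr q ∧ HasLFP q := by
  obtain ⟨r, C, x, Φ, hr, hC, hΦ, rfl, htr, hdet, hPE⟩ := exists_phase_family hp
  have hV := (hΦ.continuousAt.preimage_mem_nhds hW : Φ ⁻¹' W ∈ 𝓝 x)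
  have hcurve : Tendsto (fun α : ℝ => (x.1, α)) (𝓝 x.2) (𝓝 x) :=
    (continuous_const.prodMk continuous_id).tendsto' _ _ rfl
  obtain ⟨α, ⟨n, hn⟩, hαW, hαPE⟩ :=
    (Measure.dense_of_ae (ae_exists_le_abs_cos x.1)).inter_nhds_nonempty
      (hcurve (inter_mem hV hPE))
  refine ⟨_, hαW, hαPE, lsr_pos_and_hasLFP hαPE (c := C * (1 / ((n : ℝ) + 1))) (by positivity)
    fun k => ?_⟩
  rw [htr, hdet, abs_mul, abs_mul, abs_of_pos hC, abs_of_pos (pow_pos hr k)]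
  calc C * (1 / ((n : ℝ) + 1)) * r ^ k / (k + 1) ^ 2
      = r ^ k * (C * (1 / ((n : ℝ) + 1) * (1 / ((k : ℝ) + 1) ^ 2))) := by ring
    _ ≤ _ := by
      gcongr
      exact hn k

theorem exists_near_not_hasLFP {p : Mat 2 × Mat 2} (hp : p ∈ setPE) {W : Set (Mat 2 × Mat 2)}
    (hW : W ∈ 𝓝 p) : ∃ q ∈ W, q ∈ setPE ∧ 0 < lsr q ∧ ¬ HasLFP q := by
  obtain ⟨p', hp'W, hp', hpos, -⟩ := exists_near_lsr_pos hp (interior_mem_nhds.2 hW)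
  have hW' : W ∈ 𝓝 p' := mem_interior_iff_mem_nhds.1 hp'W
  clear hp hp'W hW
  obtain ⟨r, C, x, Φ, hr, hC, hΦ, rfl, htr, hdet, hPE⟩ := exists_phase_family hp'
  have hV := (hΦ.continuousAt.preimage_mem_nhds hW' : Φ ⁻¹' W ∈ 𝓝 x)
  have hle := lsr_le_sqrt_det hp'
  rw [hdet] at hle
  have habs : ∀ y, ∀ k : ℕ, |((Φ y).1 * (Φ y).2 ^ k).trace| =
      r ^ (k + 1) * (C / r * |Real.cos (k * y.1 + y.2)|) := by
    intro y k
    rw [htr, abs_mul, abs_mul, abs_of_pos hC, abs_of_pos (pow_pos hr k), pow_succ]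
    field_simp
  set l : ℝ := lsr (Φ x) / r / 2 with hl
  have hl0 : 0 < l := by positivity
  have hl1 : l < 1 := by
    have : lsr (Φ x) / r ≤ 1 := (div_le_one hr).2 hle
    linarith
  have hx : x ∈ marginSet (C / r) l := by
    refine ⟨lsr (Φ x) / r, by rw [hl]; linarith [div_pos hpos hr], fun k => ?_⟩
    rw [div_pow, div_le_iff₀' (by positivity), ← habs]
    exact lsr_pow_le hp' k
  obtain ⟨y, ⟨hyW, hyPE⟩, hy1, hy2⟩ :=
    exists_not_attained (div_pos hC hr) hl0 hx (inter_mem hV hPE)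
  have hlt : ∀ k : ℕ, (r * l) ^ (k + 1) < |((Φ y).1 * (Φ y).2 ^ k).trace| := by
    intro k
    rw [habs, mul_pow]
    gcongr
    exact hy1 k
  have hrl : r * l < r := mul_lt_of_lt_one_right hr hl1
  have heq : lsr (Φ y) = r * l := by
    refine le_antisymm (le_of_forall_gt_imp_ge_of_dense fun μ hμ => ?_)
      (le_lsr hyPE (by rw [hdet]; exact hrl.le) fun k => (hlt k).le)
    obtain ⟨k, hk⟩ := hy2 (μ / r) (by rwa [lt_div_iff₀' hr])
    have hμ0 : 0 ≤ μ := (mul_pos hr hl0).le.trans hμ.le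
    refine le_of_pow_le_pow_left₀ (n := k + 1) (by omega) hμ0 ((lsr_pow_le hyPE k).trans ?_)
    rw [habs]
    rw [div_pow, lt_div_iff₀' (by positivity)] at hk
    exact hk.le
  refine ⟨_, hyW, hyPE, ?_, not_hasLFP hyPE ?_ ?_⟩
  · rw [heq]
    positivity
  · rw [heq, hdet]
    exact hrl
  · rw [heq]
    exact hlt

/-- Density in the subspace `setPE`, tested on neighbourhoods in the ambient space. -/
theorem denseInPE_of_forall {S : Set (Mat 2 × Mat 2)}
    (h : ∀ p ∈ setPE, ∀ W ∈ 𝓝 p, ∃ q ∈ W, q ∈ setPE ∧ q ∈ S) : DenseInPE S := by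
  intro p
  rw [mem_closure_iff_nhds]
  intro V hV
  obtain ⟨W, hW, hWV⟩ := mem_nhds_subtype _ _ _ |>.1 hV
  obtain ⟨q, hqW, hq, hqS⟩ := h p p.2 W hW
  exact ⟨⟨q, hq⟩, hWV hqW, hqS⟩

theorem continuousAt_of_lsr_eq_zero {p : Mat 2 × Mat 2} (h : lsr p = 0) : ContinuousAt lsr p := by
  rw [ContinuousAt, h, tendsto_order]
  refine ⟨fun a ha => Eventually.of_forall fun q => ha.trans_le (lsr_nonneg q), fun a ha => ?_⟩
  exact (isOpen_lsr_lt a).mem_nhds (by rwa [mem_ofPred_eq, h])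

theorem not_continuousWithinAt {D : Set (Mat 2 × Mat 2)} (hD : setPE ⊆ D) {p : Mat 2 × Mat 2}
    (hp : p ∈ setPE) (h : 0 < lsr p) : ¬ ContinuousWithinAt lsr D p := by
  intro hc
  obtain ⟨W, hW, hWD⟩ := mem_nhdsWithin_iff_exists_mem_nhds_inter.1
    (hc.eventually (lt_mem_nhds h))
  obtain ⟨q, hqW, hq, hq0, -⟩ := exists_near_lsr_eq_zero hp hW
  exact (hWD ⟨hqW, hD hq⟩ : 0 < lsr q).ne' hq0

theorem setPE_eq (D : Set (Mat 2 × Mat 2)) (hD : setPE ⊆ D) :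
    setPE = U₁ D ∪ U₂ D ∪ U₃ D ∪ U₄ D := by
  ext p
  constructor
  · intro hp
    rcases (lsr_nonneg p).eq_or_lt with h | h
    · have hc := (continuousAt_of_lsr_eq_zero h.symm).continuousWithinAt (s := D)
      by_cases hf : HasLFP p
      · exact Or.inl (Or.inl (Or.inr ⟨hp, h.symm, hc, hf⟩))
      · exact Or.inl (Or.inl (Or.inl ⟨hp, h.symm, hc, hf⟩))
    · have hc := not_continuousWithinAt hD hp h
      by_cases hf : HasLFP p
      · exact Or.inr ⟨hp, h, hc, hf⟩
      · exact Or.inl (Or.inr ⟨hp, h, hc, hf⟩)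
  · rintro (((h | h) | h) | h) <;> exact h.1

theorem pairwise_disjoint_U (D : Set (Mat 2 × Mat 2)) :
    [U₁ D, U₂ D, U₃ D, U₄ D].Pairwise Disjoint := by
  simp only [List.pairwise_cons, List.mem_cons, List.not_mem_nil, or_false, forall_eq_or_imp,
    forall_eq, Set.disjoint_left, List.Pairwise.nil, and_true, IsEmpty.forall_iff, implies_true]
  refine ⟨⟨?_, ?_, ?_⟩, ⟨?_, ?_⟩, ?_⟩
  · exact fun p h h' => h.2.2.2 h'.2.2.2
  · exact fun p h h' => h'.2.1.ne' h.2.1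
  · exact fun p h h' => h'.2.1.ne' h.2.1
  · exact fun p h h' => h'.2.1.ne' h.2.1
  · exact fun p h h' => h'.2.1.ne' h.2.1
  · exact fun p h h' => h.2.2.2 h'.2.2.2

theorem baireSpace_setPE : BaireSpace setPE := by
  have hcont : Continuous fun p : Mat 2 × Mat 2 => p.1.det := continuous_fst.matrix_det
  have hcont' : Continuous fun p : Mat 2 × Mat 2 => p.1.trace := continuous_fst.matrix_trace
  have hcont2 : Continuous fun p : Mat 2 × Mat 2 => p.2.det := continuous_snd.matrix_det
  have hcont2' : Continuous fun p : Mat 2 × Mat 2 => p.2.trace := continuous_snd.matrix_trace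
  have heq : setPE = {p | p.1.det = 0} ∩ ({p | p.1.trace ≠ 0} ∩
      {p | p.2.trace ^ 2 < 4 * p.2.det}) := by
    ext p
    rw [setPE, mem_prod, mem_setP_iff, mem_setE_iff, and_assoc]
    rfl
  have hlc : IsLocallyClosed setPE := by
    rw [heq]
    exact (isClosed_eq hcont continuous_const).isLocallyClosed.inter
      ((isOpen_ne_fun hcont' continuous_const).inter
        (isOpen_lt (hcont2'.pow 2) (hcont2.const_mul 4))).isLocallyClosed
  have : LocallyCompactSpace (Mat 2) := inferInstanceAs (LocallyCompactSpace (Fin 2 → Fin 2 → ℝ))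
  have : LocallyCompactSpace setPE := hlc.locallyCompactSpace
  infer_instance

/-- The conditions of index `n` in the description of the pairs with vanishing lower spectral
radius and without lower finiteness. -/
def residualPart (n : ℕ) : Set setPE :=
  {p | lsr p < 1 / ((n : ℝ) + 1)} ∩
    {p | ((p : Mat 2 × Mat 2).1 * (p : Mat 2 × Mat 2).2 ^ n).trace ≠ 0}

theorem isOpen_dense_residualPart (n : ℕ) : IsOpen (residualPart n) ∧ Dense (residualPart n) := by
  have h1 : IsOpen {p : setPE | lsr p < 1 / ((n : ℝ) + 1)} :=
    (isOpen_lsr_lt _).preimage continuous_subtype_val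
  have h2 : IsOpen {p : setPE |
      ((p : Mat 2 × Mat 2).1 * (p : Mat 2 × Mat 2).2 ^ n).trace ≠ 0} := by
    refine isOpen_ne_fun (Continuous.matrix_trace ?_) continuous_const
    exact (continuous_fst.comp continuous_subtype_val).mul
      ((continuous_snd.comp continuous_subtype_val).pow n)
  refine ⟨h1.inter h2, Dense.inter_of_isOpen_left ?_ ?_ h1⟩
  · refine denseInPE_of_forall (S := {p | lsr p < 1 / ((n : ℝ) + 1)}) fun p hp W hW => ?_
    obtain ⟨q, hqW, hq, hq0, -⟩ := exists_near_lsr_eq_zero hp hW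
    refine ⟨q, hqW, hq, ?_⟩
    rw [mem_ofPred_eq, hq0]
    positivity
  · refine denseInPE_of_forall (S := {p | (p.1 * p.2 ^ n).trace ≠ 0}) fun p hp W hW => ?_
    obtain ⟨q, hqW, hq, hq0, -⟩ := exists_near_lsr_pos hp hW
    exact ⟨q, hqW, hq, fun h => hq0.ne' (lsr_eq_zero_of_trace hq h)⟩

theorem U₁_eq (D : Set (Mat 2 × Mat 2)) : U₁ D = Subtype.val '' (⋂ n, residualPart n) := by
  ext p
  constructor
  · rintro ⟨hp, h0, -, hf⟩
    refine ⟨⟨p, hp⟩, mem_iInter.2 fun n => ⟨?_, fun h => hf (hasLFP_of_eq_trace hp (k := n) ?_)⟩,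
      rfl⟩
    · change lsr p < _
      rw [h0]
      positivity
    · rw [h, h0]
      simp
  · rintro ⟨⟨p, hp⟩, h, rfl⟩
    rw [mem_iInter] at h
    have h0 : lsr p = 0 := by
      refine le_antisymm (le_of_forall_pos_lt_add fun ε hε => ?_) (lsr_nonneg p)
      obtain ⟨n, hn⟩ := exists_nat_one_div_lt hε
      rw [zero_add]
      exact (h n).1.trans hn
    refine ⟨hp, h0, (continuousAt_of_lsr_eq_zero h0).continuousWithinAt, not_hasLFP hp ?_ ?_⟩
    · rw [h0]
      exact sqrt_det_pos hp.2
    · intro k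
      rw [h0, zero_pow (by omega)]
      exact abs_pos.2 (h k).2

theorem dense_U₁ (D : Set (Mat 2 × Mat 2)) : DenseInPE (U₁ D) := by
  have := baireSpace_setPE
  rw [U₁_eq, DenseInPE, preimage_image_eq _ Subtype.val_injective]
  exact dense_iInter_of_isOpen (fun n => (isOpen_dense_residualPart n).1)
    fun n => (isOpen_dense_residualPart n).2

/-! ### Full Lebesgue measure -/

/-- The complex structures with positive upper right entry, in global coordinates. -/
noncomputable def chartJ (p q : ℝ) : Mat 2 :=
  !![p, Real.exp q; -((1 + p ^ 2) * Real.exp (-q)), -p]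

theorem chartJ_mul_self (p q : ℝ) : chartJ p q * chartJ p q = -1 := by
  have h : Real.exp q * Real.exp (-q) = 1 := by rw [← Real.exp_add]; simp
  ext i j
  fin_cases i <;> fin_cases j <;> simp [chartJ, Matrix.mul_apply, Fin.sum_univ_two]
  · linear_combination (-(1 + p ^ 2)) * h
  · ring
  · ring
  · linear_combination (-(1 + p ^ 2)) * h

theorem eq_chartJ {J : Mat 2} (hJ : J * J = -1) (h : 0 < J 0 1) :
    J = chartJ (J 0 0) (Real.log (J 0 1)) := by
  obtain ⟨h1, h2⟩ := trace_eq_zero_and_det_eq_one hJ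
  rw [Matrix.trace_fin_two] at h1
  rw [Matrix.det_fin_two] at h2
  have h3 : J 1 1 = - J 0 0 := by linarith
  rw [h3] at h2
  ext i j
  fin_cases i <;> fin_cases j <;> simp [chartJ, Real.exp_neg, Real.exp_log h]
  · field_simp
    linarith
  · exact h3

/-- A global parametrization of `setPE` by seven real coordinates. The right factor of the rank-one
matrix is `(1, x 6)` for `(e, f) = (1, 0)` and `(x 6, 1)` for `(e, f) = (0, 1)`. Its left factor is
given in polar coordinates, with angle `x 0`, with respect to the complex structure of the elliptic
matrix. -/
noncomputable def chart (e f : ℝ) (x : Fin 7 → ℝ) : Mat 2 × Mat 2 :=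
  (x 5 • (rot (chartJ (x 3) (x 4)) (x 0) * Matrix.vecMulVec ![1, 0] ![e + f * x 6, f + e * x 6]),
    x 2 • rot (chartJ (x 3) (x 4)) (x 1))

/-- The trace of `A * B ^ k` in the coordinates of `chart`, up to the factor `x 5 * x 2 ^ k`. -/
noncomputable def chartTrace (e f : ℝ) (k : ℕ) (x : Fin 7 → ℝ) : ℝ :=
  Real.cos (k * x 1 + x 0) * (e + f * x 6) + Real.sin (k * x 1 + x 0) *
    (x 3 * (e + f * x 6) - (1 + x 3 ^ 2) * Real.exp (-x 4) * (f + e * x 6))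

theorem trace_chart (e f : ℝ) (k : ℕ) (x : Fin 7 → ℝ) :
    ((chart e f x).1 * (chart e f x).2 ^ k).trace = x 5 * x 2 ^ k * chartTrace e f k x := by
  have hJ := chartJ_mul_self (x 3) (x 4)
  dsimp only [chart]
  rw [smul_rot_pow hJ, smul_mul_smul_comm, Matrix.trace_smul, Matrix.trace_mul_comm, ← mul_assoc,
    rot_mul_rot hJ, smul_eq_mul]
  congr 1
  simp [rot, chartJ, chartTrace, Matrix.trace_fin_two, Matrix.mul_apply, Fin.sum_univ_two]
  ring

theorem exists_chart_eq {p : Mat 2 × Mat 2} (hp : p ∈ setPE) :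
    ∃ x : Fin 7 → ℝ, 0 < x 2 ∧ (chart 1 0 x = p ∨ chart 0 1 x = p) := by
  obtain ⟨A, B⟩ := p
  obtain ⟨hA, hB⟩ := hp
  obtain ⟨J, r, t, hJ, hJ01, hr, rfl⟩ := exists_eq_smul_rot hB
  obtain ⟨hd, ht⟩ := mem_setP_iff.1 hA
  dsimp only at hA hB hd ht
  rw [eq_chartJ hJ hJ01]
  set a := J 0 0
  set q := Real.log (J 0 1)
  have hne : (1 + a ^ 2) * Real.exp (-q) ≠ 0 := by positivity
  have hpolar : ∀ u v : ℝ, ∃ s β : ℝ, u = s * (Real.cos β + Real.sin β * a) ∧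
      v = s * (Real.sin β * -((1 + a ^ 2) * Real.exp (-q))) := by
    intro u v
    set c := v / -((1 + a ^ 2) * Real.exp (-q)) with hc
    obtain ⟨s, β, -, h1, h2⟩ := exists_polar (u - c * a) c
    refine ⟨s, β, ?_, ?_⟩
    · linear_combination h1 + a * h2
    · have : v = c * -((1 + a ^ 2) * Real.exp (-q)) := by
        rw [hc]
        field_simp
      rw [this, h2]
      ring
  rw [Matrix.trace_fin_two] at ht
  rw [Matrix.det_fin_two] at hd
  by_cases h0 : A 0 0 = 0
  · have h1 : A 1 1 ≠ 0 := fun h => ht (by simp [h0, h])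
    obtain ⟨s, β, hu, hv⟩ := hpolar (A 0 1) (A 1 1)
    refine ⟨![β, t, r, a, q, s, A 1 0 / A 1 1], hr, Or.inr (Prod.ext ?_ rfl)⟩
    ext i j
    fin_cases i <;> fin_cases j <;>
      simp [chart, rot, chartJ, Matrix.mul_apply, Fin.sum_univ_two]
    · rw [← mul_assoc, ← hu, h0]
      have : A 0 1 * A 1 0 = 0 := by rw [h0] at hd; linarith
      rw [← mul_div_assoc, this, zero_div]
    · exact hu.symm
    · have : A 1 1 * (A 1 0 / A 1 1) = A 1 0 := by field_simp
      rw [hv] at this ⊢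
      linear_combination this
    · linarith
  · obtain ⟨s, β, hu, hv⟩ := hpolar (A 0 0) (A 1 0)
    refine ⟨![β, t, r, a, q, s, A 0 1 / A 0 0], hr, Or.inl (Prod.ext ?_ rfl)⟩
    ext i j
    fin_cases i <;> fin_cases j <;>
      simp [chart, rot, chartJ, Matrix.mul_apply, Fin.sum_univ_two]
    · exact hu.symm
    · rw [← mul_assoc, ← hu]
      field_simp
    · linarith
    · have : A 1 1 = A 1 0 * (A 0 1 / A 0 0) := by
        field_simp
        linarith
      rw [this, hv]
      ring

/-- The parameters at which the traces admit a polynomial lower bound. -/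
def goodParams (e f : ℝ) : Set (Fin 7 → ℝ) :=
  {x | ∃ n : ℕ, ∀ k : ℕ, 1 / ((n : ℝ) + 1) * (1 / ((k : ℝ) + 1) ^ 2) ≤ |chartTrace e f k x|}

theorem measurableSet_goodParams (e f : ℝ) : MeasurableSet (goodParams e f) := by
  simp only [goodParams, ofPred_exists, ofPred_forall]
  refine MeasurableSet.iUnion fun n => MeasurableSet.iInter fun k => ?_
  refine (isClosed_le continuous_const (Continuous.abs ?_)).measurableSet
  unfold chartTrace
  fun_prop

/-- For fixed values of the other coordinates, the traces are a constant multiple of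
`cos (k θ + β + γ)`, where `β` is the coordinate of index `0`. -/
theorem ae_mem_goodParams {e f : ℝ} (hef : e = 1 ∧ f = 0 ∨ e = 0 ∧ f = 1) :
    ∀ᵐ x : Fin 7 → ℝ, x ∈ goodParams e f := by
  have hmp := volume_preserving_piFinSuccAbove (fun _ : Fin 7 => ℝ) 0
  set E := MeasurableEquiv.piFinSuccAbove (fun _ : Fin 7 => ℝ) 0
  have hprod : ∀ᵐ z : ℝ × (Fin 6 → ℝ), E.symm z ∈ goodParams e f := by
    have hmeas : MeasurableSet {z : ℝ × (Fin 6 → ℝ) | E.symm z ∈ goodParams e f} :=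
      E.symm.measurable (measurableSet_goodParams e f)
    refine (Measure.ae_prod_iff_ae_ae hmeas).2 ?_
    rw [Measure.ae_ae_comm hmeas]
    refine Eventually.of_forall fun z => ?_
    -- all coordinates but the angle of the rank-one matrix are fixed
    set a : ℝ := e + f * z 5
    set b : ℝ := z 2 * (e + f * z 5) - (1 + z 2 ^ 2) * Real.exp (-z 3) * (f + e * z 5)
    obtain ⟨R, γ, hR, ha, hb⟩ := exists_polar a (-b)
    have hR0 : 0 < R := by
      refine lt_of_le_of_ne hR ?_
      rintro rfl
      have hpos : (1 + z 2 ^ 2) * Real.exp (-z 3) ≠ 0 := by positivity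
      have ha' : e + f * z 5 = 0 := by simpa [a] using ha
      have hb' : f + e * z 5 = 0 := by
        have : b = 0 := by simpa using hb
        simp only [b, ha', mul_zero, zero_sub, neg_eq_zero] at this
        exact (mul_eq_zero.1 this).resolve_left hpos
      rcases hef with ⟨rfl, rfl⟩ | ⟨rfl, rfl⟩ <;> simp at ha' hb'
    have hshift := (measurePreserving_add_right volume γ).quasiMeasurePreserving.ae
      (ae_exists_le_abs_cos (z 0))
    filter_upwards [hshift] with β ⟨n, hn⟩
    obtain ⟨n', hn'⟩ := exists_nat_one_div_lt (by positivity : 0 < R * (1 / ((n : ℝ) + 1)))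
    refine ⟨n', fun k => ?_⟩
    have hval : chartTrace e f k (E.symm (β, z)) = R * Real.cos (k * z 0 + (β + γ)) := by
      have : chartTrace e f k (E.symm (β, z)) =
        Real.cos (k * z 0 + β) * a + Real.sin (k * z 0 + β) * b := rfl
      rw [this, ← add_assoc, Real.cos_add (_ + _) γ]
      linear_combination Real.cos (k * z 0 + β) * ha - Real.sin (k * z 0 + β) * hb
    rw [hval, abs_mul, abs_of_pos hR0]
    calc 1 / ((n' : ℝ) + 1) * (1 / ((k : ℝ) + 1) ^ 2)
        ≤ R * (1 / ((n : ℝ) + 1)) * (1 / ((k : ℝ) + 1) ^ 2) := by gcongr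
      _ = R * (1 / ((n : ℝ) + 1) * (1 / ((k : ℝ) + 1) ^ 2)) := by ring
      _ ≤ _ := by
        gcongr
        exact hn k
  have := hmp.quasiMeasurePreserving.ae hprod
  simpa using this

theorem contDiff_entries_chart (e f : ℝ) : ContDiff ℝ 1 fun x => entries (chart e f x) := by
  rw [contDiff_euclidean]
  rintro (⟨i, j⟩ | ⟨i, j⟩) <;> fin_cases i <;> fin_cases j <;>
    simp [entries, chart, rot, chartJ, Matrix.mul_apply, Fin.sum_univ_two] <;> fun_prop

/-- Locally Lipschitz images of Lebesgue null sets are null for the Hausdorff measure of the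
dimension of the source. -/
theorem hausdorffMeasure_image_eq_zero {n : ℕ} {Y : Type*} [MetricSpace Y] [MeasurableSpace Y]
    [BorelSpace Y] {g : (Fin n → ℝ) → Y} (hg : LocallyLipschitz g) {s : Set (Fin n → ℝ)}
    (hs : volume s = 0) : Measure.hausdorffMeasure n (g '' s) = 0 := by
  choose K t ht hK using hg
  obtain ⟨c, hc, hcover⟩ := TopologicalSpace.countable_cover_nhds ht
  have hsub : g '' s ⊆ ⋃ x ∈ c, g '' (s ∩ t x) := by
    rintro _ ⟨y, hy, rfl⟩
    have : y ∈ ⋃ x ∈ c, t x := hcover ▸ mem_univ y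
    simp only [mem_iUnion] at this ⊢
    obtain ⟨x, hx, hyx⟩ := this
    exact ⟨x, hx, y, ⟨hy, hyx⟩, rfl⟩
  refine measure_mono_null hsub ((measure_biUnion_null_iff hc).2 fun x _ => ?_)
  have h1 := ((hK x).mono inter_subset_right).hausdorffMeasure_image_le (s := s ∩ t x)
    (Nat.cast_nonneg n : (0 : ℝ) ≤ n)
  have h2 : Measure.hausdorffMeasure (n : ℝ) (s ∩ t x) = 0 := by
    have h3 := hausdorffMeasure_pi_real (ι := Fin n)
    rw [Fintype.card_fin] at h3
    rw [h3]
    exact measure_mono_null inter_subset_left hs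
  rw [h2, mul_zero] at h1
  exact le_antisymm h1 bot_le

theorem mem_U₄_of_mem_goodParams {D : Set (Mat 2 × Mat 2)} (hD : setPE ⊆ D) {e f : ℝ}
    {x : Fin 7 → ℝ} (hx : x ∈ goodParams e f) (hr : 0 < x 2) (hp : chart e f x ∈ setPE) :
    chart e f x ∈ U₄ D := by
  obtain ⟨n, hn⟩ := hx
  have h5 : x 5 ≠ 0 := by
    intro h
    have := trace_chart e f 0 x
    rw [h, zero_mul, zero_mul, pow_zero, mul_one] at this
    exact (mem_setP_iff.1 hp.1).2 this
  have hdet : √(chart e f x).2.det = x 2 :=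
    sqrt_det_smul_rot (chartJ_mul_self (x 3) (x 4)) hr (x 1)
  obtain ⟨h1, h2⟩ := lsr_pos_and_hasLFP hp (c := |x 5| * (1 / ((n : ℝ) + 1))) (by positivity)
    fun k => by
      rw [hdet, trace_chart, abs_mul, abs_mul, abs_of_pos (pow_pos hr k)]
      calc |x 5| * (1 / ((n : ℝ) + 1)) * x 2 ^ k / (k + 1) ^ 2
          = |x 5| * x 2 ^ k * (1 / ((n : ℝ) + 1) * (1 / ((k : ℝ) + 1) ^ 2)) := by ring
        _ ≤ _ := by
          gcongr
          exact hn k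
  exact ⟨hp, h1, not_continuousWithinAt hD hp h1, h2⟩

theorem fullLebesgueMeasureInPE_U₄ {D : Set (Mat 2 × Mat 2)} (hD : setPE ⊆ D) :
    FullLebesgueMeasureInPE (U₄ D) := by
  have hnull : ∀ e f : ℝ, (e = 1 ∧ f = 0 ∨ e = 0 ∧ f = 1) →
      Measure.hausdorffMeasure 7 ((fun x => entries (chart e f x)) '' (goodParams e f)ᶜ) = 0 := by
    intro e f hef
    exact_mod_cast hausdorffMeasure_image_eq_zero (contDiff_entries_chart e f).locallyLipschitz
      (ae_mem_goodParams hef)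
  refine measure_mono_null ?_ (measure_union_null (hnull 1 0 (by simp)) (hnull 0 1 (by simp)))
  rintro _ ⟨p, ⟨hp, hpU⟩, rfl⟩
  obtain ⟨x, hr, rfl | rfl⟩ := exists_chart_eq hp
  · exact Or.inl ⟨x, fun hx => hpU (mem_U₄_of_mem_goodParams hD hx hr hp), rfl⟩
  · exact Or.inr ⟨x, fun hx => hpU (mem_U₄_of_mem_goodParams hD hx hr hp), rfl⟩

end LowerSpectral

theorem mainTheorem1 (D : Set (LowerSpectral.Mat 2 × LowerSpectral.Mat 2))
    (hD : LowerSpectral.setPE ⊆ D) :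
    (LowerSpectral.setPE =
        LowerSpectral.U₁ D ∪ LowerSpectral.U₂ D ∪ LowerSpectral.U₃ D ∪ LowerSpectral.U₄ D) ∧
    [LowerSpectral.U₁ D, LowerSpectral.U₂ D, LowerSpectral.U₃ D,
        LowerSpectral.U₄ D].Pairwise Disjoint ∧
    LowerSpectral.DenseInPE (LowerSpectral.U₁ D) ∧
    LowerSpectral.DenseInPE (LowerSpectral.U₂ D) ∧
    LowerSpectral.DenseInPE (LowerSpectral.U₃ D) ∧
    LowerSpectral.DenseInPE (LowerSpectral.U₄ D) ∧
    (∃ O : ℕ → Set LowerSpectral.setPE, (∀ n, IsOpen (O n) ∧ Dense (O n)) ∧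
        LowerSpectral.U₁ D = Subtype.val '' (⋂ n, O n)) ∧
    LowerSpectral.FullLebesgueMeasureInPE (LowerSpectral.U₄ D) := by
  open LowerSpectral in
  refine ⟨setPE_eq D hD, pairwise_disjoint_U D, dense_U₁ D, ?_, ?_, ?_,
    ⟨residualPart, isOpen_dense_residualPart, U₁_eq D⟩, fullLebesgueMeasureInPE_U₄ hD⟩
  · refine denseInPE_of_forall fun p hp W hW => ?_
    obtain ⟨q, hqW, hq, h0, hf⟩ := exists_near_lsr_eq_zero hp hW
    exact ⟨q, hqW, hq, hq, h0, (continuousAt_of_lsr_eq_zero h0).continuousWithinAt, hf⟩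
  · refine denseInPE_of_forall fun p hp W hW => ?_
    obtain ⟨q, hqW, hq, h0, hf⟩ := exists_near_not_hasLFP hp hW
    exact ⟨q, hqW, hq, hq, h0, not_continuousWithinAt hD hq h0, hf⟩
  · refine denseInPE_of_forall fun p hp W hW => ?_
    obtain ⟨q, hqW, hq, h0, hf⟩ := exists_near_lsr_pos hp hW
    exact ⟨q, hqW, hq, hq, h0, not_continuousWithinAt hD hq h0, hf⟩
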